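/- **Setting.** Let $n\ge 1$. For nonnegative bi-infinite sequences $I=(I_k)_{k\in\mathbb Z}$, $\omega=(\omega_k)_{k\in\mathbb Z}$ with $$\lim_{m\to-\infty}\sum_{i=m}^0(\omega_i-I_{i+1})=-\infty \qquad(*)$$ let $G$ be any function on $\mathbb Z$ with $G_k-G_{k-1}=I_k$, put $\widetilde G_\ell=\sup_{k\le \ell}\{G_k+\sum_{i=k}^{\ell}\omega_i\}$ and define the sequence $D(I,\omega)$ by $D(I,\omega)_\ell=\widetilde G_\ell-\widetilde G_{\ell-1}$ (it does not depend on the choice of $G$). Put $D^{(1)}(\zeta^1)=\zeta^1$ and $D^{(k)}(\zeta^1,\dots,\zeta^k)=D\bigl(D^{(k-1)}(\zeta^1,\dots,\zeta^{k-1}),\zeta^k\bigr)$ for $k\ge2$. *The measures $\mu^\rho$.* For $\sigma=(\sigma_1,\dots,\sigma_m)$ with $0<\sigma_1<\dots<\sigma_m$ let $I=(I^1,\dots,I^m)$ be such that all $I^i_k$ ($1\le i\le m$, $k\in\mathbb Z$) are independent and $I^i_k$ is exponential with mean $\sigma_i$; then $\mu^\sigma$ is the law of $(\zeta^1,\dots,\zeta^m)$,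 $\zeta^i=D^{(i)}(I^i,I^{i-1},\dots,I^1)$. For general $\rho\in(0,\infty)^n$ let $\sigma_1<\dots<\sigma_m$ be the distinct values among $\rho_1,\dots,\rho_n$ and $\zeta\sim\mu^\sigma$; then $\mu^\rho$ is the law of $\eta=(\eta^1,\dots,\eta^n)$, where $\eta^i=\zeta^\ell$ for the index $\ell$ with $\rho_i=\sigma_\ell$. *The coupled process.* It is the Markov chain on $n$-tuples $\eta=(\eta^1,\dots,\eta^n)$ of nonnegative bi-infinite sequences, $\eta^i=(\eta^i_k)_{k\in\mathbb Z}$, with transition $$\eta\longmapsto\bigl(D(\eta^1,\omega),\dots,D(\eta^n,\omega)\bigr),$$ where at each step $\omega=(\omega_k)_{k\in\mathbb Z}$ is a fresh sequence of i.i.d. $\mathrm{Exp}(1)$ variables, independent of the past. A probability measure $\mu$ is *invariant* for it if, for $\eta\sim\mu$ and an independent $\omega$ as above, almost surely $(*)$ holds for every pair $(\eta^i,\omega)$, and $(D(\eta^1,\omega),\dots,D(\eta^n,\omega))\sim\mu$. (The first requirement is automatic for measures on $\mathcal A_n$ below.) Let - $\mathcal A_n$ be the set of nonnegative $\eta$ such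 that for every $i$ the limit $\lim_{m\to-\infty}\frac1{|m|}\sum_{k=m}^0\eta^i_k$ exists, is finite and is $>1$; - $\mathcal X_n$ be the set of nonnegative $\eta$ with $\eta^{i-1}_k\le\eta^i_k$ for all $2\le i\le n$ and $k\in\mathbb Z$, and $\liminf_{m\to-\infty}\frac1{|m|}\sum_{k=m}^0\eta^1_k>0$. A probability measure is *translation-ergodic* if it is invariant under all translations $(\theta_\ell\eta)^i_k=\eta^i_{k+\ell}$ ($\ell\in\mathbb Z$) and gives probability $0$ or $1$ to every measurable set invariant under all $\theta_\ell$. It has *mean vector* $\rho$ if every $\eta^i_k$ is integrable with expectation $\rho_i$. **Theorem.** 1. (Existence.) For every $\rho\in(1,\infty)^n$, $\mu^\rho$ is a translation-ergodic probability measure supported on $\mathcal A_n$, has mean vector $\rho$, and is invariant for the coupled process. 2. (Uniqueness on $\mathcal A_n$.) Let $\rho\in(1,\infty)^n$. If $\widetilde\mu$ is a translation-ergodic probability measure on $\mathcal A_n$ with mean vector $\rho$ that is invariant for the coupled process, then $\widetilde\mu=\mu^\rho$. 3. (Uniqueness on $\mathcal X_n$.) If $\widetilde\mu$ is a translation-ergodic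 probability measure on $\mathcal X_n$ with finite mean vector $\rho$ that is invariant for the coupled process, then $\rho\in(1,\infty)^n$ and $\widetilde\mu=\mu^\rho$. -/

import Mathlib

open MeasureTheory ProbabilityTheory Filter Topology

noncomputable section

namespace CoupledQueues

/-- Bi-infinite real sequences `(x_k)_{k ∈ ℤ}`. Nonnegativity is imposed where the state spaces
are introduced. The `σ`-algebra is the product (equivalently, Borel) one. -/
abbrev BiSeq : Type := ℤ → ℝ

/-- `n`-tuples `(η^1, …, η^n)` of bi-infinite sequences; `η i k` is `η^i_k` (`i` counted from
`0`). -/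
abbrev Config (n : ℕ) : Type := Fin n → BiSeq

/-! ### The queueing operator -/

/-- The function `G` on `ℤ` with `G 0 = 0` and increments `G k - G (k - 1) = I k`. -/
def height (I : BiSeq) (k : ℤ) : ℝ := ∑ i ∈ Finset.Ioc 0 k, I i - ∑ i ∈ Finset.Ioc k 0, I i

/-- `G~_ℓ = sup_{k ≤ ℓ} (G_k + ∑_{i=k}^ℓ ω_i)`. -/
def heightOut (I ω : BiSeq) (l : ℤ) : ℝ :=
  ⨆ k : Set.Iic l, (height I k + ∑ i ∈ Finset.Icc (k : ℤ) l, ω i)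

/-- The departure process `D(I, ω)`: the increments of `G~`. It is meaningful when
`Stable I ω` holds (the suprema are then finite). -/
def departure (I ω : BiSeq) : BiSeq := fun l => heightOut I ω l - heightOut I ω (l - 1)

/-- The condition `lim_{m → -∞} ∑_{i=m}^0 (ω_i - I_{i+1}) = -∞` under which `D(I, ω)` is
well defined. -/
def Stable (I ω : BiSeq) : Prop :=
  Tendsto (fun m : ℤ => ∑ i ∈ Finset.Icc m 0, (ω i - I (i + 1))) atBot atBot

/-- Departure process from queues in series: `tandem ζ k = D^{(k+1)}(ζ_0, ζ_1, …, ζ_k)`, where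
`D^{(1)}(ζ_0) = ζ_0` and `D^{(k+1)}(ζ_0, …, ζ_k) = D(D^{(k)}(ζ_0, …, ζ_{k-1}), ζ_k)`. -/
def tandem (ζ : ℕ → BiSeq) : ℕ → BiSeq
  | 0 => ζ 0
  | k + 1 => departure (tandem ζ k) (ζ (k + 1))

/-- The map `(I^1, …, I^n) ↦ (η^1, …, η^n)`, `η^i = D^{(i)}(I^i, I^{i-1}, …, I^1)`. -/
def multiqueue {n : ℕ} (I : Config n) : Config n :=
  fun i => tandem (fun j => I ⟨i.val - j, lt_of_le_of_lt (Nat.sub_le _ _) i.isLt⟩) i.val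

/-- One step of the coupled process: `(η^1, …, η^n) ↦ (D(η^1, ω), …, D(η^n, ω))`. -/
def coupledStep {n : ℕ} (η : Config n) (ω : BiSeq) : Config n := fun i => departure (η i) ω

/-! ### Measurability of these maps -/

lemma height_sub (I : BiSeq) (k : ℤ) : height I k - height I (k - 1) = I k := by
  unfold height
  rcases lt_or_ge 0 k with h | h
  · have h1 : Finset.Ioc k 0 = ∅ := Finset.Ioc_eq_empty (by omega)
    have h2 : Finset.Ioc (k - 1) 0 = ∅ := Finset.Ioc_eq_empty (by omega)
    have h3 : Finset.Ioc 0 k = insert k (Finset.Ioc 0 (k - 1)) := by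
      ext x; simp only [Finset.mem_Ioc, Finset.mem_insert]; omega
    rw [h1, h2, h3, Finset.sum_insert (by simp)]
    simp
  · have h1 : Finset.Ioc 0 k = ∅ := Finset.Ioc_eq_empty (by omega)
    have h2 : Finset.Ioc 0 (k - 1) = ∅ := Finset.Ioc_eq_empty (by omega)
    have h3 : Finset.Ioc (k - 1) 0 = insert k (Finset.Ioc k 0) := by
      ext x; simp only [Finset.mem_Ioc, Finset.mem_insert]; omega
    rw [h1, h2, h3, Finset.sum_insert (by simp)]
    simp

lemma measurable_departure {α : Type*} [MeasurableSpace α] {f g : α → BiSeq}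
    (hf : Measurable f) (hg : Measurable g) : Measurable (fun a => departure (f a) (g a)) := by
  have h : ∀ l : ℤ, Measurable (fun a => heightOut (f a) (g a) l) := by
    intro l
    unfold heightOut height
    refine Measurable.iSup fun k => ?_
    fun_prop
  exact measurable_pi_lambda _ fun l => (h l).sub (h (l - 1))

lemma measurable_coupledStep (n : ℕ) :
    Measurable (fun p : Config n × BiSeq => coupledStep p.1 p.2) :=
  measurable_pi_lambda _ fun i => measurable_departure
    (f := fun p : Config n × BiSeq => p.1 i) (g := fun p : Config n × BiSeq => p.2)
    ((measurable_pi_apply i).comp measurable_fst) measurable_snd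

lemma measurable_tandem {α : Type*} [MeasurableSpace α] (ζ : ℕ → α → BiSeq)
    (hζ : ∀ j, Measurable (ζ j)) (k : ℕ) : Measurable (fun a => tandem (fun j => ζ j a) k) := by
  induction k with
  | zero => exact hζ 0
  | succ k ih => exact measurable_departure ih (hζ (k + 1))

lemma measurable_multiqueue (n : ℕ) : Measurable (multiqueue : Config n → Config n) :=
  measurable_pi_lambda _ fun i => measurable_tandem
    (fun j (I : Config n) => I ⟨i.val - j, lt_of_le_of_lt (Nat.sub_le _ _) i.isLt⟩)
    (fun _ => measurable_pi_apply _) i.val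

/-! ### State spaces -/

/-- The Cesàro average `|m|⁻¹ ∑_{k=m}^0 x_k`, used as `m → -∞`. -/
def leftAverage (x : BiSeq) (m : ℤ) : ℝ := |(m : ℝ)|⁻¹ * ∑ k ∈ Finset.Icc m 0, x k

/-- The state space `A_n`: nonnegative sequences whose Cesàro averages to the left converge to
limits `> 1`. -/
def stateSpace (n : ℕ) : Set (Config n) :=
  {η | (∀ i k, 0 ≤ η i k) ∧ ∀ i, ∃ L : ℝ, 1 < L ∧ Tendsto (leftAverage (η i)) atBot (𝓝 L)}

/-- The space `X_n`: nonnegative sequences with `η^1 ≤ η^2 ≤ … ≤ η^n` coordinatewise and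
`liminf_{m → -∞} |m|⁻¹ ∑_{k=m}^0 η^1_k > 0`. -/
def orderedSpace (n : ℕ) : Set (Config n) :=
  {η | (∀ i k, 0 ≤ η i k) ∧ (∀ i j, i ≤ j → ∀ k, η i k ≤ η j k) ∧
    ∀ i : Fin n, i.val = 0 → ∃ c : ℝ, 0 < c ∧ ∀ᶠ m in atBot, c ≤ leftAverage (η i) m}

/-! ### Exponential sequences and the measures `μ^ρ` -/

/-- The exponential distribution with mean `m > 0`, i.e. with rate `m⁻¹` (and, by convention, the
point mass at `0` if `m ≤ 0`). -/
def expMean (m : ℝ) : Measure ℝ := if 0 < m then expMeasure m⁻¹ else Measure.dirac 0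

instance (m : ℝ) : IsProbabilityMeasure (expMean m) := by
  unfold expMean
  split_ifs with h
  · exact isProbabilityMeasure_expMeasure (inv_pos.mpr h)
  · infer_instance

/-- The law of an i.i.d. sequence of exponential variables with mean `m`. -/
def expSeq (m : ℝ) : Measure BiSeq := Measure.infinitePi fun _ : ℤ => expMean m

instance (m : ℝ) : IsProbabilityMeasure (expSeq m) := by unfold expSeq; infer_instance

/-- `ν^σ`: all coordinates `I^i_k` are independent and `I^i_k` is exponential with mean `σ_i`. -/
def nu {n : ℕ} (σ : Fin n → ℝ) : Measure (Config n) := Measure.pi fun i => expSeq (σ i)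

/-- `μ^σ` for strictly increasing positive `σ`: the image of `ν^σ` under the multiqueue map. -/
def muStrict {n : ℕ} (σ : Fin n → ℝ) : Measure (Config n) := (nu σ).map multiqueue

/-- The finite set of values of `ρ`. -/
def values {n : ℕ} (ρ : Fin n → ℝ) : Finset ℝ := Finset.univ.image ρ

/-- The distinct values `σ_1 < … < σ_m` of `ρ` in increasing order. -/
def sortedValues {n : ℕ} (ρ : Fin n → ℝ) : Fin (values ρ).card → ℝ :=
  (values ρ).orderEmbOfFin rfl

/-- The position of `ρ i` among the distinct values of `ρ`. -/
def valueIndex {n : ℕ} (ρ : Fin n → ℝ) (i : Fin n) : Fin (values ρ).card :=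
  ((values ρ).orderIsoOfFin rfl).symm ⟨ρ i, Finset.mem_image_of_mem ρ (Finset.mem_univ i)⟩

/-- `μ^ρ` for general `ρ`: if `σ_1 < … < σ_m` are the distinct values of `ρ` and `ζ ∼ μ^σ`, then
`μ^ρ` is the law of `(η^1, …, η^n)` where `η^i = ζ^ℓ` for the index `ℓ` with `ρ_i = σ_ℓ`. -/
def mu {n : ℕ} (ρ : Fin n → ℝ) : Measure (Config n) :=
  (muStrict (sortedValues ρ)).map fun ζ i => ζ (valueIndex ρ i)

/-- `μ^ρ` can be computed from any enumeration of the values of `ρ` in increasing order. -/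
lemma mu_eq_of_factor {n m : ℕ} (ρ : Fin n → ℝ) (σ : Fin m → ℝ) (hσ : StrictMono σ)
    (f : Fin n → Fin m) (hf : Function.Surjective f) (h : ∀ i, ρ i = σ (f i)) :
    mu ρ = (muStrict σ).map fun ζ i => ζ (f i) := by
  have hv : values ρ = Finset.univ.image σ := by
    ext x
    simp only [values, Finset.mem_image, Finset.mem_univ, true_and]
    constructor
    · rintro ⟨i, rfl⟩; exact ⟨f i, (h i).symm⟩
    · rintro ⟨j, rfl⟩
      obtain ⟨i, rfl⟩ := hf j
      exact ⟨i, h i⟩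
  have hc : (values ρ).card = m := by
    rw [hv, Finset.card_image_of_injective _ hσ.injective]; simp
  subst hc
  have hs : σ = sortedValues ρ :=
    Finset.orderEmbOfFin_unique rfl (fun x => by rw [hv]; simp) hσ
  have hi : f = valueIndex ρ := by
    funext i
    apply hσ.injective
    rw [← h i, hs]
    unfold sortedValues valueIndex
    rw [← Finset.coe_orderIsoOfFin_apply]
    simp
  rw [hi, hs]
  rfl

/-- For strictly increasing `ρ`, `μ^ρ` is the image of `ν^ρ` under the multiqueue map. -/
lemma mu_of_strictMono {n : ℕ} (ρ : Fin n → ℝ) (hρ : StrictMono ρ) : mu ρ = muStrict ρ := by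
  rw [mu_eq_of_factor ρ ρ hρ id Function.surjective_id (fun _ => rfl)]
  exact Measure.map_id

/-! ### The coupled process and its invariant measures -/

/-- The transition kernel of the coupled process: from the state `η`, the next state is
`(D(η^1, ω), …, D(η^n, ω))` with a fresh sequence `ω` of i.i.d. exponential variables with
mean `1`. -/
def coupledKernel (n : ℕ) : Kernel (Config n) (Config n) :=
  (Kernel.id ×ₖ Kernel.const (Config n) (expSeq 1)).map fun p => coupledStep p.1 p.2

instance (n : ℕ) : IsMarkovKernel (coupledKernel n) :=
  Kernel.IsMarkovKernel.map _ (measurable_coupledStep n)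

lemma coupledKernel_apply (n : ℕ) (η : Config n) :
    coupledKernel n η = (expSeq 1).map (coupledStep η) := by
  have h := measurable_coupledStep n
  rw [coupledKernel, Kernel.map_apply _ h, Kernel.prod_apply, Kernel.id_apply,
    Kernel.const_apply, Measure.dirac_prod, Measure.map_map h (by fun_prop)]
  rfl

/-- `μ` is invariant for the coupled process: started from `μ`, with an independent driving
sequence, the step is almost surely well defined, and it preserves `μ`. The first condition
is automatic for measures on `stateSpace n`. -/
structure IsInvariantForCoupled {n : ℕ} (μ : Measure (Config n)) : Prop where
  stable : ∀ᵐ p ∂(μ.prod (expSeq 1)), ∀ i, Stable (p.1 i) p.2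
  invariant : Kernel.Invariant (coupledKernel n) μ

/-- Translation `(θ_l η)^i_k = η^i_{k + l}`. -/
def translate {n : ℕ} (l : ℤ) (η : Config n) : Config n := fun i k => η i (k + l)

/-- Translation-ergodicity: `μ` is invariant under all translations, and events that are invariant
under all translations have probability `0` or `1`. -/
structure IsTranslationErgodic {n : ℕ} (μ : Measure (Config n)) : Prop where
  invariant : ∀ l : ℤ, MeasurePreserving (translate l) μ μ
  trivial_of_invariant : ∀ A : Set (Config n), MeasurableSet A →
    (∀ l : ℤ, translate l ⁻¹' A = A) → μ A = 0 ∨ μ A = 1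

/-- All coordinates `η^i_k` have finite mean, and `E^μ[η^i_k] = ρ_i`. -/
def HasMeanVector {n : ℕ} (μ : Measure (Config n)) (ρ : Fin n → ℝ) : Prop :=
  ∀ i k, Integrable (fun η : Config n => η i k) μ ∧ ∫ η, η i k ∂μ = ρ i

end CoupledQueues

end

noncomputable section

namespace CoupledQueues

/-! ### Sums over integer intervals -/

/-! Existence rests on two facts about one queue with arrivals `I`, services `ω`, departures `D` and
dual services `R = min(I_l, J_{l-1})`. The first is an intertwining identity, D(D(A, I), ω) = D(D(A,
R), D): passing from `(I, ω)` to `(R, D)` preserves last passage values on two lines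
(`FiniteQueue.lastPassage_eq`), and two queues in series see their services only through these
values (`departure_departure`). The second is Burke's theorem: if `I` and `ω` are independent i.i.d.
exponential sequences, then `D` and `R` are again independent with the same laws
(`measurePreserving_burke`).

Feed `ω` into the first line of a multiqueue, the resulting `R` into the second line, and so on. By
Burke's theorem the departures from the lines have the law of the original lines, and by the
intertwining identity one step of the coupled process is the multiqueue map of these departures
(`coupledStep_multiqueue`). Hence the image measure is invariant. It is translation-ergodic as an
equivariant image of independent variables. Its means are correct because D − I is the increment of
the stationary sojourn time, a coboundary bounded below by −I, so that it has mean zero even though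
the sojourn time is not known to be integrable.

Uniqueness is a contraction argument. Among the translation-invariant couplings of two invariant
ergodic measures, choose one minimising the expected ℓ¹ distance at a site; compactness and lower
semicontinuity provide it. Drive both marginals with the same `ω`. Since |a − b| = 2 max(a, b) − a −
b, means are conserved, and D is monotone, the distance cannot increase; by minimality it cannot
decrease, so D of the maximum is almost surely the maximum of the two D's. If the two sequences
crossed, an independent, very long service before the crossings would create a busy period covering
both, and at its end the departure of the maximum would exceed both departures strictly. Hence no
crossing occurs. On the invariant event where one sequence is somewhere smaller it is then smaller
everywhere, but ergodicity of the marginals gives both the same mean on every invariant event, so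
they agree.

This comparison needs no average to the left, only stability, which belongs to invariance. The means
exceed `1` because D ≥ ω, with strict inequality whenever the server idles (`one_lt_of_invariant`).
The third assertion thus follows in the same way as the second. -/

lemma sum_Icc_succ_right (x : BiSeq) {k l : ℤ} (h : k ≤ l + 1) :
    ∑ i ∈ Finset.Icc k (l + 1), x i = ∑ i ∈ Finset.Icc k l, x i + x (l + 1) := by
  have : Finset.Icc k (l + 1) = insert (l + 1) (Finset.Icc k l) := by
    ext y; simp only [Finset.mem_Icc, Finset.mem_insert]; omega
  rw [this, Finset.sum_insert (by simp), add_comm]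

lemma sum_Icc_succ_left (x : BiSeq) {k l : ℤ} (h : k ≤ l) :
    ∑ i ∈ Finset.Icc k l, x i = x k + ∑ i ∈ Finset.Icc (k + 1) l, x i := by
  have : Finset.Icc k l = insert k (Finset.Icc (k + 1) l) := by
    ext y; simp only [Finset.mem_Icc, Finset.mem_insert]; omega
  rw [this, Finset.sum_insert (by simp)]

lemma sum_Icc_append (x : BiSeq) {k m l : ℤ} (h : k ≤ m + 1) (h' : m ≤ l) :
    ∑ i ∈ Finset.Icc k l, x i = ∑ i ∈ Finset.Icc k m, x i + ∑ i ∈ Finset.Icc (m + 1) l, x i := by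
  rw [← Finset.sum_union]
  · congr 1
    ext y; simp only [Finset.mem_Icc, Finset.mem_union]; omega
  · rw [Finset.disjoint_left]
    intro y; simp only [Finset.mem_Icc]; omega

lemma height_zero (I : BiSeq) : height I 0 = 0 := by simp [height]

lemma height_succ (I : BiSeq) (k : ℤ) : height I (k + 1) = height I k + I (k + 1) := by
  have := height_sub I (k + 1)
  rw [add_sub_cancel_right] at this
  linarith

lemma height_eq_add_sum (I : BiSeq) {k l : ℤ} (h : k ≤ l) :
    height I l = height I k + ∑ i ∈ Finset.Icc (k + 1) l, I i := by
  induction l, h using Int.leInduction with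
  | base => simp
  | succ l hl ih => rw [height_succ, ih, sum_Icc_succ_right I (by omega), add_assoc]

/-! ### Finite queues -/

/-- The quantity `G_k + ∑_{i=k}^ℓ ω_i` whose supremum over `k ≤ ℓ` is `heightOut I ω ℓ`. -/
def pathWeight (I ω : BiSeq) (l k : ℤ) : ℝ := height I k + ∑ i ∈ Finset.Icc k l, ω i

/-- All the suprema defining `heightOut` are finite. -/
def FiniteQueue (I ω : BiSeq) : Prop :=
  ∀ l, BddAbove (Set.range fun k : Set.Iic l => pathWeight I ω l k)

/-- The sojourn time `J_ℓ` of customer `ℓ`. -/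
def sojourn (I ω : BiSeq) (l : ℤ) : ℝ := heightOut I ω l - height I l

/-- The dual service times `R_ℓ = I_ℓ ∧ J_{ℓ-1}`. -/
def dualService (I ω : BiSeq) : BiSeq := fun l => min (I l) (sojourn I ω (l - 1))

lemma pathWeight_succ (I ω : BiSeq) {k l : ℤ} (h : k ≤ l + 1) :
    pathWeight I ω (l + 1) k = pathWeight I ω l k + ω (l + 1) := by
  unfold pathWeight
  rw [sum_Icc_succ_right ω h]; ring

lemma pathWeight_eq_add_sum (I ω : BiSeq) {k m l : ℤ} (h : k ≤ m + 1) (h' : m ≤ l) :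
    pathWeight I ω l k = pathWeight I ω m k + ∑ i ∈ Finset.Icc (m + 1) l, ω i := by
  unfold pathWeight
  rw [sum_Icc_append ω h h']; ring

lemma pathWeight_self (I ω : BiSeq) (l : ℤ) : pathWeight I ω l l = height I l + ω l := by
  simp [pathWeight]

lemma FiniteQueue.le_heightOut {I ω : BiSeq} (h : FiniteQueue I ω) {k l : ℤ} (hk : k ≤ l) :
    pathWeight I ω l k ≤ heightOut I ω l :=
  le_ciSup (h l) (⟨k, hk⟩ : Set.Iic l)

lemma heightOut_le {I ω : BiSeq} {l : ℤ} {c : ℝ} (h : ∀ k ≤ l, pathWeight I ω l k ≤ c) :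
    heightOut I ω l ≤ c := by
  have : Nonempty (Set.Iic l) := ⟨⟨l, le_refl l⟩⟩
  exact ciSup_le fun k => h k k.2

lemma finiteQueue_of_forall_le {I ω : BiSeq} (h : ∀ l, ∃ c, ∀ k ≤ l, pathWeight I ω l k ≤ c) :
    FiniteQueue I ω := by
  intro l
  obtain ⟨c, hc⟩ := h l
  exact ⟨c, by rintro _ ⟨k, rfl⟩; exact hc k k.2⟩

/-- Customer `l + 1` enters service at the later of its arrival and the departure of customer `l`:
an optimal path starts at `l + 1` or earlier, and in the second case it is an optimal path to `l`
prolonged by one service. -/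
lemma FiniteQueue.heightOut_succ {I ω : BiSeq} (h : FiniteQueue I ω) (l : ℤ) :
    heightOut I ω (l + 1) = max (height I (l + 1)) (heightOut I ω l) + ω (l + 1) := by
  apply le_antisymm
  · apply heightOut_le
    intro k hk
    rw [pathWeight_succ I ω hk]
    rcases eq_or_lt_of_le hk with rfl | hk
    · gcongr
      simp [pathWeight]
    · gcongr
      exact (h.le_heightOut (by omega)).trans (le_max_right _ _)
  · rw [← le_sub_iff_add_le]
    apply max_le
    · have := h.le_heightOut (le_refl (l + 1))
      rw [pathWeight_self] at this
      linarith
    · apply heightOut_le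
      intro k hk
      have := h.le_heightOut (show k ≤ l + 1 by omega)
      rw [pathWeight_succ I ω (by omega)] at this
      linarith

lemma FiniteQueue.sojourn_succ {I ω : BiSeq} (h : FiniteQueue I ω) (l : ℤ) :
    sojourn I ω (l + 1) = ω (l + 1) + max (sojourn I ω l - I (l + 1)) 0 := by
  unfold sojourn
  rw [h.heightOut_succ, height_succ]
  rcases le_total (height I l + I (l + 1)) (heightOut I ω l) with h1 | h1
  · rw [max_eq_right h1, max_eq_left (by linarith)]; ring
  · rw [max_eq_left h1, max_eq_right (by linarith)]; ring

lemma departure_eq_add_sojourn (I ω : BiSeq) (l : ℤ) :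
    departure I ω (l + 1) = I (l + 1) + (sojourn I ω (l + 1) - sojourn I ω l) := by
  simp only [departure, sojourn, height_succ, add_sub_cancel_right]
  ring

lemma departure_eq_add_sojourn' (I ω : BiSeq) (l : ℤ) :
    departure I ω l = I l + (sojourn I ω l - sojourn I ω (l - 1)) := by
  have := departure_eq_add_sojourn I ω (l - 1)
  rwa [sub_add_cancel] at this

lemma FiniteQueue.departure_succ {I ω : BiSeq} (h : FiniteQueue I ω) (l : ℤ) :
    departure I ω (l + 1) = ω (l + 1) + max (I (l + 1) - sojourn I ω l) 0 := by
  rw [departure_eq_add_sojourn, h.sojourn_succ]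
  rcases le_total (sojourn I ω l) (I (l + 1)) with h1 | h1
  · rw [max_eq_right (by linarith), max_eq_left (by linarith)]; ring
  · rw [max_eq_left (by linarith), max_eq_right (by linarith)]; ring

lemma FiniteQueue.le_departure {I ω : BiSeq} (h : FiniteQueue I ω) (l : ℤ) :
    ω l ≤ departure I ω l := by
  have := h.departure_succ (l - 1)
  rw [sub_add_cancel] at this
  rw [this]
  linarith [le_max_right (I l - sojourn I ω (l - 1)) 0]

lemma FiniteQueue.le_sojourn {I ω : BiSeq} (h : FiniteQueue I ω) (l : ℤ) :
    ω l ≤ sojourn I ω l := by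
  have := h.sojourn_succ (l - 1)
  rw [sub_add_cancel] at this
  rw [this]
  linarith [le_max_right (sojourn I ω (l - 1) - I l) 0]

lemma dualService_succ (I ω : BiSeq) (l : ℤ) :
    dualService I ω (l + 1) = min (I (l + 1)) (sojourn I ω l) := by
  simp [dualService]

/-- The idle time `(I - J)⁺` in the departure is what `min I J` lacks to be `I`. This local
conservation law starts the induction for last passage values and determines the average of the dual
services. -/
lemma FiniteQueue.departure_add_dualService {I ω : BiSeq} (h : FiniteQueue I ω) (l : ℤ) :
    departure I ω l + dualService I ω l = I l + ω l := by
  have h1 := h.departure_succ (l - 1)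
  have h2 := dualService_succ I ω (l - 1)
  rw [sub_add_cancel] at h1 h2
  rw [h1, h2]
  rcases le_total (sojourn I ω (l - 1)) (I l) with h1 | h1
  · rw [min_eq_right h1, max_eq_left (by linarith)]; ring
  · rw [min_eq_left h1, max_eq_right (by linarith)]; ring

lemma dualService_le (I ω : BiSeq) (l : ℤ) : dualService I ω l ≤ I l := min_le_left _ _

lemma FiniteQueue.dualService_nonneg {I ω : BiSeq} (h : FiniteQueue I ω) (hI : ∀ k, 0 ≤ I k)
    (hω : ∀ k, 0 ≤ ω k) (l : ℤ) : 0 ≤ dualService I ω l :=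
  le_min (hI l) ((hω _).trans (h.le_sojourn _))

/-! ### Stability -/

/-- Turns `Stable` into divergence of path weights; the index shift in `I (i + 1)` is the origin of
the constant `height I 1`. -/
lemma sum_sub_eq_pathWeight (I ω : BiSeq) {m : ℤ} (hm : m ≤ 1) :
    ∑ i ∈ Finset.Icc m 0, (ω i - I (i + 1)) = pathWeight I ω 0 m - height I 1 := by
  induction m, hm using Int.leInductionDown with
  | base => simp [pathWeight]
  | pred m hm ih =>
    have e := sum_Icc_succ_left (fun i => ω i - I (i + 1)) (show m - 1 ≤ 0 by omega)
    have e' := sum_Icc_succ_left ω (show m - 1 ≤ 0 by omega)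
    have e'' := height_sub I m
    simp only [sub_add_cancel] at e e'
    rw [e, ih, pathWeight, pathWeight, e']
    linarith

lemma Stable.tendsto_pathWeight {I ω : BiSeq} (h : Stable I ω) (l : ℤ) :
    Tendsto (pathWeight I ω l) atBot atBot := by
  have h0 : Tendsto (pathWeight I ω 0) atBot atBot := by
    have h1 : Tendsto (fun m : ℤ => ∑ i ∈ Finset.Icc m 0, (ω i - I (i + 1)) + height I 1)
        atBot atBot := tendsto_atBot_add_const_right _ _ h
    refine h1.congr' ?_
    filter_upwards [eventually_le_atBot 1] with m hm
    rw [sum_sub_eq_pathWeight I ω hm]; ring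
  rcases le_total 0 l with hl | hl
  · refine (tendsto_atBot_add_const_right _ (∑ i ∈ Finset.Icc (0 + 1) l, ω i) h0).congr' ?_
    filter_upwards [eventually_le_atBot 0] with m hm
    rw [pathWeight_eq_add_sum I ω (by omega : m ≤ 0 + 1) hl]
  · refine (tendsto_atBot_add_const_right _ (-∑ i ∈ Finset.Icc (l + 1) 0, ω i) h0).congr' ?_
    filter_upwards [eventually_le_atBot l] with m hm
    rw [pathWeight_eq_add_sum I ω (by omega : m ≤ l + 1) hl]; ring

lemma stable_of_tendsto_pathWeight {I ω : BiSeq} (h : Tendsto (pathWeight I ω 0) atBot atBot) :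
    Stable I ω := by
  refine (tendsto_atBot_add_const_right _ (-height I 1) h).congr' ?_
  filter_upwards [eventually_le_atBot 1] with m hm
  rw [sum_sub_eq_pathWeight I ω hm]; ring

lemma Stable.finiteQueue {I ω : BiSeq} (h : Stable I ω) : FiniteQueue I ω := by
  apply finiteQueue_of_forall_le
  intro l
  obtain ⟨K, hK⟩ := (eventually_atBot.1 ((h.tendsto_pathWeight l).eventually_le_atBot 0))
  refine ⟨0 ⊔ ∑ k ∈ Finset.Icc K l, |pathWeight I ω l k|, fun k hk => ?_⟩
  rcases le_total k K with h1 | h1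
  · exact (hK k h1).trans le_sup_left
  · refine le_trans ?_ le_sup_right
    exact (le_abs_self _).trans (Finset.single_le_sum (f := fun k => |pathWeight I ω l k|)
      (fun _ _ => abs_nonneg _) (Finset.mem_Icc.2 ⟨h1, hk⟩))

lemma Stable.mono {I I' ω : BiSeq} (h : Stable I ω) (hI : ∀ k, I k ≤ I' k) : Stable I' ω := by
  refine tendsto_atBot_mono (fun m => ?_) h
  gcongr with i _
  exact hI _

/-- A sojourn time is a supremum over `k` of services minus the interarrival times in `(k, l]`, and
each term decreases in the arrivals. -/
lemma sojourn_anti {I I' ω : BiSeq} (h : FiniteQueue I ω) (hI : ∀ k, I k ≤ I' k) (l : ℤ) :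
    sojourn I' ω l ≤ sojourn I ω l := by
  unfold sojourn
  rw [sub_le_iff_le_add]
  apply heightOut_le
  intro k hk
  have h1 := h.le_heightOut hk
  unfold pathWeight at h1 ⊢
  have h2 := height_eq_add_sum I hk
  have h3 := height_eq_add_sum I' hk
  have h4 : ∑ i ∈ Finset.Icc (k + 1) l, I i ≤ ∑ i ∈ Finset.Icc (k + 1) l, I' i :=
    Finset.sum_le_sum fun i _ => hI i
  linarith

/-- The idle time `(I - J)⁺` increases with `I` and decreases with `J`, and `J` itself decreases
when `I` grows. -/
lemma departure_mono {I I' ω : BiSeq} (h : FiniteQueue I ω) (h' : FiniteQueue I' ω)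
    (hI : ∀ k, I k ≤ I' k) (l : ℤ) : departure I ω l ≤ departure I' ω l := by
  have h1 := h.departure_succ (l - 1)
  have h2 := h'.departure_succ (l - 1)
  rw [sub_add_cancel] at h1 h2
  rw [h1, h2]
  have := sojourn_anti h hI (l - 1)
  have := hI l
  gcongr

/-- While the server never idles, sojourn times are partial sums. -/
lemma FiniteQueue.sojourn_of_busy {I ω : BiSeq} (h : FiniteQueue I ω) {l : ℤ}
    (hl : I (l + 1) ≤ sojourn I ω l) :
    sojourn I ω (l + 1) = sojourn I ω l - I (l + 1) + ω (l + 1) := by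
  rw [h.sojourn_succ, max_eq_left (by linarith)]; ring

/-- A stable queue has been idle infinitely often in the past. -/
lemma Stable.exists_idle {I ω : BiSeq} (h : Stable I ω) (l : ℤ) :
    ∃ k ≤ l, sojourn I ω (k - 1) < I k := by
  by_contra! hc
  have hf := h.finiteQueue
  have key : ∀ k ≤ l, heightOut I ω l = heightOut I ω k + ∑ i ∈ Finset.Icc (k + 1) l, ω i := by
    intro k hk
    induction k, hk using Int.leInductionDown with
    | base => simp
    | pred k hk ih =>
      have h1 := hf.heightOut_succ (k - 1)
      have h2 := hc k hk
      have h3 := sum_Icc_succ_left ω hk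
      have h4 := height_sub I k
      rw [sub_add_cancel] at h1
      unfold sojourn at h2
      rw [max_eq_right (by linarith)] at h1
      rw [sub_add_cancel, h3, ih, h1]
      ring
  -- Without idling, `heightOut` loses exactly the services on the way back from `l`. But the paths
  -- from far enough back have total weight at most `heightOut I ω l - 1`, so the supremum at `min K
  -- l` would be too small by `1`.
  obtain ⟨K, hK⟩ := eventually_atBot.1
    ((h.tendsto_pathWeight l).eventually_le_atBot (heightOut I ω l - 1))
  have h1 := key (min K l) (min_le_right _ _)
  have h2 : heightOut I ω (min K l) ≤
      heightOut I ω l - 1 - ∑ i ∈ Finset.Icc (min K l + 1) l, ω i := by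
    apply heightOut_le
    intro k hk
    have h3 := hK k (hk.trans (min_le_left _ _))
    rw [pathWeight_eq_add_sum I ω (by omega : k ≤ min K l + 1) (min_le_right _ _)] at h3
    linarith
  linarith

/-! ### Translations -/

/-- Translation of a single sequence. -/
def shift (l : ℤ) (x : BiSeq) : BiSeq := fun k => x (k + l)

lemma sum_Icc_shift (s : ℤ) (x : BiSeq) (k l : ℤ) :
    ∑ i ∈ Finset.Icc k l, shift s x i = ∑ i ∈ Finset.Icc (k + s) (l + s), x i := by
  rw [← Finset.image_add_right_Icc, Finset.sum_image (by intro a _ b _ h; simpa using h)]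
  rfl

lemma height_shift (s : ℤ) (x : BiSeq) (k : ℤ) :
    height (shift s x) k = height x (k + s) - height x s := by
  induction k using Int.induction_on with
  | zero => simp [height_zero]
  | succ k ih =>
    rw [height_succ, ih, add_right_comm, height_succ]
    simp only [shift, add_right_comm]; ring
  | pred k ih =>
    have h1 := height_sub (shift s x) (-k)
    have h2 := height_sub x (-k + s)
    rw [show -(k : ℤ) - 1 + s = -k + s - 1 by ring]
    have : shift s x (-k) = x (-k + s) := rfl
    linarith

lemma pathWeight_shift (s : ℤ) (I ω : BiSeq) (l k : ℤ) :
    pathWeight (shift s I) (shift s ω) l k = pathWeight I ω (l + s) (k + s) - height I s := by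
  unfold pathWeight
  rw [height_shift, sum_Icc_shift]; ring

lemma finiteQueue_shift {I ω : BiSeq} (h : FiniteQueue I ω) (s : ℤ) :
    FiniteQueue (shift s I) (shift s ω) := by
  apply finiteQueue_of_forall_le
  intro l
  refine ⟨heightOut I ω (l + s) - height I s, fun k hk => ?_⟩
  rw [pathWeight_shift]
  have := h.le_heightOut (show k + s ≤ l + s by omega)
  linarith

lemma heightOut_shift_eq (s : ℤ) (I ω : BiSeq) (l : ℤ) (h : FiniteQueue I ω) :
    heightOut (shift s I) (shift s ω) l = heightOut I ω (l + s) - height I s := by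
  apply le_antisymm
  · apply heightOut_le
    intro k hk
    rw [pathWeight_shift]
    have := h.le_heightOut (show k + s ≤ l + s by omega)
    linarith
  · rw [sub_le_iff_le_add]
    apply heightOut_le
    intro k hk
    have := (finiteQueue_shift h s).le_heightOut (show k - s ≤ l by omega)
    rw [pathWeight_shift, sub_add_cancel] at this
    linarith

/-- Changing the endpoint alters the weights of all remote paths by one constant, so the suprema are
finite for every `l` or for none. -/
lemma finiteQueue_of_bddAbove {I ω : BiSeq} {m : ℤ}
    (h : BddAbove (Set.range fun k : Set.Iic m => pathWeight I ω m k)) : FiniteQueue I ω := by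
  obtain ⟨c, hc⟩ := h
  have hc' : ∀ k ≤ m, pathWeight I ω m k ≤ c := fun k hk => hc ⟨⟨k, hk⟩, rfl⟩
  apply finiteQueue_of_forall_le
  intro l
  rcases le_total l m with hl | hl
  · refine ⟨c - ∑ i ∈ Finset.Icc (l + 1) m, ω i, fun k hk => ?_⟩
    have := hc' k (hk.trans hl)
    rw [pathWeight_eq_add_sum I ω (by omega : k ≤ l + 1) hl] at this
    linarith
  · refine ⟨(c + ∑ i ∈ Finset.Icc (m + 1) l, ω i) ⊔
      ∑ k ∈ Finset.Icc m l, |pathWeight I ω l k|, fun k hk => ?_⟩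
    rcases le_total k m with h1 | h1
    · rw [pathWeight_eq_add_sum I ω (by omega : k ≤ m + 1) hl]
      have := hc' k h1
      exact le_sup_of_le_left (by linarith)
    · refine le_trans ?_ le_sup_right
      exact (le_abs_self _).trans (Finset.single_le_sum (f := fun k => |pathWeight I ω l k|)
        (fun _ _ => abs_nonneg _) (Finset.mem_Icc.2 ⟨h1, hk⟩))

lemma heightOut_eq_zero_of_not_finiteQueue {I ω : BiSeq} (h : ¬ FiniteQueue I ω) (l : ℤ) :
    heightOut I ω l = 0 :=
  Real.iSup_of_not_bddAbove fun hb => h (finiteQueue_of_bddAbove (m := l) hb)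

lemma shift_shift_neg (s : ℤ) (x : BiSeq) : shift (-s) (shift s x) = x := by
  funext k; simp [shift]

/-- No stability is needed: for a queue with infinite suprema `heightOut` takes the default value
`0` everywhere and both sides vanish. Hence the multiqueue map is equivariant pointwise, not just
almost surely. -/
lemma departure_shift (s : ℤ) (I ω : BiSeq) :
    departure (shift s I) (shift s ω) = shift s (departure I ω) := by
  funext l
  by_cases h : FiniteQueue I ω
  · simp only [departure, heightOut_shift_eq s I ω _ h, shift]
    rw [show l - 1 + s = l + s - 1 by ring]; ring
  · have h' : ¬ FiniteQueue (shift s I) (shift s ω) := by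
      intro h'
      have := finiteQueue_shift h' (-s)
      rw [shift_shift_neg, shift_shift_neg] at this
      exact h this
    simp [departure, heightOut_eq_zero_of_not_finiteQueue h,
      heightOut_eq_zero_of_not_finiteQueue h', shift]

lemma FiniteQueue.sojourn_shift {I ω : BiSeq} (h : FiniteQueue I ω) (s l : ℤ) :
    sojourn (shift s I) (shift s ω) l = sojourn I ω (l + s) := by
  simp only [sojourn, heightOut_shift_eq s I ω _ h, height_shift]; ring

/-! ### Last passage percolation on two lines and the intertwining identity -/

/-- The last passage value `max_{k ≤ j ≤ k + n} (∑_{i=k}^j x_i + ∑_{i=j}^{k+n} y_i)`. -/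
def lastPassage (x y : BiSeq) (k : ℤ) : ℕ → ℝ
  | 0 => x k + y k
  | n + 1 => max (lastPassage x y k n) (∑ i ∈ Finset.Icc k (k + n + 1), x i) + y (k + n + 1)

lemma le_lastPassage (x y : BiSeq) (k : ℤ) (n : ℕ) {j : ℤ} (h1 : k ≤ j) (h2 : j ≤ k + n) :
    ∑ i ∈ Finset.Icc k j, x i + ∑ i ∈ Finset.Icc j (k + n), y i ≤ lastPassage x y k n := by
  induction n with
  | zero =>
    obtain rfl : j = k := by push_cast at h2; omega
    simp [lastPassage]
  | succ n ih =>
    push_cast at h2 ⊢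
    rw [← add_assoc] at h2 ⊢
    rw [sum_Icc_succ_right y (by omega), ← add_assoc]
    simp only [lastPassage]
    gcongr
    rcases eq_or_lt_of_le h2 with rfl | h2
    · simp
    · exact (ih (by omega)).trans (le_max_left _ _)

lemma exists_lastPassage_eq (x y : BiSeq) (k : ℤ) (n : ℕ) :
    ∃ j, k ≤ j ∧ j ≤ k + n ∧
      lastPassage x y k n = ∑ i ∈ Finset.Icc k j, x i + ∑ i ∈ Finset.Icc j (k + n), y i := by
  induction n with
  | zero => exact ⟨k, by simp [lastPassage]⟩
  | succ n ih =>
    push_cast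
    simp only [lastPassage, ← add_assoc]
    rcases le_total (lastPassage x y k n) (∑ i ∈ Finset.Icc k (k + n + 1), x i) with h | h
    · refine ⟨k + n + 1, by omega, le_refl _, ?_⟩
      rw [max_eq_right h]; simp
    · obtain ⟨j, hj1, hj2, hj⟩ := ih
      refine ⟨j, hj1, by omega, ?_⟩
      rw [max_eq_left h, sum_Icc_succ_right y (by omega), hj, add_assoc]

/-- The induction carries a dichotomy. Once the server has idled in the window, the passage value
equals arrivals plus sojourn time; until then every dual service in the window is the arrival
itself, so the two first lines have equal sums. -/
lemma FiniteQueue.lastPassage_eq_aux {I ω : BiSeq} (h : FiniteQueue I ω) (k : ℤ) (n : ℕ) :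
    lastPassage I ω k n = lastPassage (dualService I ω) (departure I ω) k n ∧
    lastPassage I ω k n ≤ ∑ i ∈ Finset.Icc k (k + n), I i + sojourn I ω (k + n) ∧
    (lastPassage I ω k n = ∑ i ∈ Finset.Icc k (k + n), I i + sojourn I ω (k + n) ∨
      ∑ i ∈ Finset.Icc k (k + n), I i = ∑ i ∈ Finset.Icc k (k + n), dualService I ω i) := by
  induction n with
  | zero =>
    have h1 := h.departure_add_dualService k
    have h2 := h.le_sojourn k
    simp only [lastPassage, CharP.cast_eq_zero, add_zero, Finset.Icc_self, Finset.sum_singleton]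
    refine ⟨by linarith, by linarith, ?_⟩
    have h3 := h.sojourn_succ (k - 1)
    have h4 := dualService_succ I ω (k - 1)
    rw [sub_add_cancel] at h3 h4
    rcases le_total (sojourn I ω (k - 1)) (I k) with h5 | h5
    · left
      rw [h3, max_eq_right (by linarith)]; ring
    · right
      rw [h4, min_eq_left h5]
  | succ n ih =>
    obtain ⟨ih1, ih2, ih3⟩ := ih
    have hle : ∑ i ∈ Finset.Icc k (k + n), dualService I ω i ≤ ∑ i ∈ Finset.Icc k (k + n), I i :=
      Finset.sum_le_sum fun i _ => dualService_le I ω i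
    push_cast
    simp only [lastPassage, ← add_assoc]
    rw [sum_Icc_succ_right I (by omega), sum_Icc_succ_right (dualService I ω) (by omega), ← ih1,
      h.departure_succ, h.sojourn_succ, dualService_succ]
    generalize lastPassage I ω k n = L at *
    generalize ∑ i ∈ Finset.Icc k (k + n), dualService I ω i = B at *
    generalize ∑ i ∈ Finset.Icc k (k + n), I i = A at *
    generalize sojourn I ω (k + n) = J at *
    generalize I (k + n + 1) = a at *
    generalize ω (k + n + 1) = w at *
    rcases le_total J a with h1 | h1
    · rw [max_eq_left (by linarith : 0 ≤ a - J), max_eq_right (by linarith : J - a ≤ 0),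
        min_eq_right h1, max_eq_right (by linarith : L ≤ A + a)]
      refine ⟨?_, by linarith, Or.inl (by ring)⟩
      rcases ih3 with h3 | h3
      · rw [max_eq_left (by linarith)]; linarith
      · rw [h3]
        rcases le_total L (B + J) with h4 | h4
        · rw [max_eq_right h4]; ring
        · have : L = B + J := by linarith
          rw [this, max_self]; ring
    · rw [max_eq_right (by linarith : a - J ≤ 0), max_eq_left (by linarith : 0 ≤ J - a),
        min_eq_left h1]
      rcases ih3 with h3 | h3
      · refine ⟨?_, ?_, Or.inl ?_⟩
        · rw [max_eq_left (by linarith), max_eq_left (by linarith)]; ring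
        · rw [max_eq_left (by linarith)]; linarith
        · rw [max_eq_left (by linarith)]; linarith
      · subst h3
        refine ⟨by ring, ?_, Or.inr rfl⟩
        have : max L (A + a) ≤ A + J := max_le ih2 (by linarith)
        linarith

/-- Passing from `(I, ω)` to `(R, D)` preserves last passage values. -/
lemma FiniteQueue.lastPassage_eq {I ω : BiSeq} (h : FiniteQueue I ω) (k : ℤ) (n : ℕ) :
    lastPassage I ω k n = lastPassage (dualService I ω) (departure I ω) k n :=
  (h.lastPassage_eq_aux k n).1

lemma height_departure (A x : BiSeq) (j : ℤ) :
    height (departure A x) j = heightOut A x j - heightOut A x 0 := by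
  induction j using Int.induction_on with
  | zero => simp [height_zero]
  | succ k ih => rw [height_succ, ih, departure, add_sub_cancel_right]; ring
  | pred k ih =>
    have h1 := height_sub (departure A x) (-k)
    simp only [departure] at h1
    linarith

/-- Both sides bound the same double family of paths `k ≤ j ≤ l`, switching from `x` to `y` at `j`;
only the order of the suprema differs. Stating it through upper bounds avoids assuming the second
queue finite. The term `heightOut A x 0` comes from normalising `height` to vanish at `0`. -/
lemma FiniteQueue.pathWeight_departure_le_iff {A x : BiSeq} (h : FiniteQueue A x) (y : BiSeq)
    (l : ℤ) (B : ℝ) :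
    (∀ j ≤ l, pathWeight (departure A x) y l j ≤ B) ↔
      ∀ k ≤ l, height A k + lastPassage x y k (l - k).toNat ≤ B + heightOut A x 0 := by
  constructor
  · intro hB k hk
    obtain ⟨j, hj1, hj2, hj⟩ := exists_lastPassage_eq x y k (l - k).toNat
    have e : k + ((l - k).toNat : ℤ) = l := by omega
    rw [e] at hj2 hj
    have h1 := hB j hj2
    have h2 := h.le_heightOut hj1
    unfold pathWeight at h1 h2
    rw [height_departure] at h1
    linarith
  · intro hB j hj
    unfold pathWeight
    rw [height_departure]
    have : heightOut A x j ≤ B + heightOut A x 0 - ∑ i ∈ Finset.Icc j l, y i := by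
      apply heightOut_le
      intro k hk
      have h1 := hB k (hk.trans hj)
      have e : k + ((l - k).toNat : ℤ) = l := by omega
      have h2 := le_lastPassage x y k (l - k).toNat hk (by omega)
      rw [e] at h2
      unfold pathWeight
      linarith
    linarith

lemma FiniteQueue.mono_service {A x x' : BiSeq} (h : FiniteQueue A x) (hx : ∀ k, x' k ≤ x k) :
    FiniteQueue A x' := by
  apply finiteQueue_of_forall_le
  intro l
  refine ⟨heightOut A x l, fun k hk => le_trans ?_ (h.le_heightOut hk)⟩
  unfold pathWeight
  gcongr with i _
  exact hx i

/-- Intertwining: the two queues in series with services `(I, ω)` have the same departures as those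
with services `(R(I, ω), D(I, ω))`. -/
lemma departure_departure {A I ω : BiSeq} (hA : FiniteQueue A I) (hI : FiniteQueue I ω)
    (hD : FiniteQueue (departure A I) ω) :
    departure (departure A I) ω =
      departure (departure A (dualService I ω)) (departure I ω) := by
  have hA' : FiniteQueue A (dualService I ω) := hA.mono_service (dualService_le I ω)
  -- Both pairs of queues have the same last passage bounds, up to a constant from the normalisation
  -- at `0`; it disappears in the increments. Finiteness of the queue on the right is also read off
  -- from this equivalence.
  have key : ∀ l B, (∀ j ≤ l, pathWeight (departure A I) ω l j ≤ B) ↔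
      ∀ j ≤ l, pathWeight (departure A (dualService I ω)) (departure I ω) l j ≤
        B + heightOut A I 0 - heightOut A (dualService I ω) 0 := by
    intro l B
    rw [hA.pathWeight_departure_le_iff, hA'.pathWeight_departure_le_iff]
    simp only [sub_add_cancel, ← hI.lastPassage_eq]
  have hD' : FiniteQueue (departure A (dualService I ω)) (departure I ω) :=
    finiteQueue_of_forall_le fun l =>
      ⟨_, (key l (heightOut (departure A I) ω l)).1 fun j hj => hD.le_heightOut hj⟩
  have e : ∀ l, heightOut (departure A I) ω l =
      heightOut (departure A (dualService I ω)) (departure I ω) l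
        - heightOut A I 0 + heightOut A (dualService I ω) 0 := by
    intro l
    apply le_antisymm
    · apply heightOut_le
      rw [key]
      intro j hj
      have := hD'.le_heightOut hj
      linarith
    · have : heightOut (departure A (dualService I ω)) (departure I ω) l ≤
          heightOut (departure A I) ω l + heightOut A I 0 - heightOut A (dualService I ω) 0 :=
        heightOut_le ((key l _).1 fun j hj => hD.le_heightOut hj)
      linarith
  funext l
  simp only [departure] at e ⊢
  rw [e l, e (l - 1)]; ring

/-! ### Cesàro averages -/

/-- A nonnegative sequence with average `a` to the left. -/
structure HasAverage (x : BiSeq) (a : ℝ) : Prop where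
  nonneg : ∀ k, 0 ≤ x k
  tendsto : Tendsto (leftAverage x) atBot (𝓝 a)

lemma HasAverage.eventually_abs_le {x : BiSeq} {a : ℝ} (h : HasAverage x a) {ε : ℝ} (hε : 0 < ε) :
    ∀ᶠ m : ℤ in atBot, |∑ k ∈ Finset.Icc m 0, x k + a * m| ≤ -(ε * m) := by
  filter_upwards [(Metric.tendsto_nhds.1 h.tendsto) ε hε, eventually_lt_atBot 0] with m hm hm0
  have hm0' : (m : ℝ) < 0 := by exact_mod_cast hm0
  rw [Real.dist_eq, leftAverage, abs_of_neg hm0'] at hm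
  have e : ∑ k ∈ Finset.Icc m 0, x k + a * m =
      (-(m : ℝ)) * ((-(m : ℝ))⁻¹ * ∑ k ∈ Finset.Icc m 0, x k - a) := by
    have : (m : ℝ) ≠ 0 := hm0'.ne
    field_simp
    ring
  rw [e, abs_mul, abs_of_pos (by linarith : 0 < -(m : ℝ))]
  nlinarith

lemma height_eq_neg_sum (I : BiSeq) {m : ℤ} (hm : m ≤ 0) :
    height I m = -∑ k ∈ Finset.Icc (m + 1) 0, I k := by
  have := height_eq_add_sum I hm
  rw [height_zero] at this
  linarith

lemma eventually_add_one_atBot {p : ℤ → Prop} (h : ∀ᶠ m in atBot, p m) :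
    ∀ᶠ m : ℤ in atBot, p (m + 1) :=
  (tendsto_atBot_add_const_right atBot (1 : ℤ) tendsto_id).eventually h

lemma HasAverage.eventually_pathWeight_le {I ω : BiSeq} {a b : ℝ} (hI : HasAverage I a)
    (hω : HasAverage ω b) {ε : ℝ} (hε : 0 < ε) :
    ∀ᶠ m : ℤ in atBot, pathWeight I ω 0 m ≤ (a - b - 2 * ε) * m + (a - ε) := by
  filter_upwards [eventually_add_one_atBot (hI.eventually_abs_le hε), hω.eventually_abs_le hε,
    eventually_le_atBot 0] with m h1 h2 h3
  unfold pathWeight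
  rw [height_eq_neg_sum I h3]
  rw [abs_le] at h1 h2
  push_cast at h1
  linarith [h1.1, h2.2]

lemma HasAverage.stable {I ω : BiSeq} {a b : ℝ} (hI : HasAverage I a) (hω : HasAverage ω b)
    (hab : b < a) : Stable I ω := by
  apply stable_of_tendsto_pathWeight
  have h := hI.eventually_pathWeight_le hω (show 0 < (a - b) / 4 by linarith)
  refine tendsto_atBot_mono' _ h ?_
  apply tendsto_atBot_add_const_right
  apply Tendsto.const_mul_atBot (by linarith)
  exact tendsto_intCast_atBot_iff.2 tendsto_id

/-- The linear bound on the weight of a path from `k` has slope `a - b - 2 * ε ≥ 0`, so over `k ≤ m`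
it is worst at `k = m`. There the main terms cancel, and the errors of the two sums in the path
weight and of the two sums over `(m, 0]` add up to `4 * ε * |m|`. -/
lemma HasAverage.eventually_sojourn_le {I ω : BiSeq} {a b : ℝ} (hI : HasAverage I a)
    (hω : HasAverage ω b) {ε : ℝ} (hε : 0 < ε) (hab : 2 * ε ≤ a - b) :
    ∀ᶠ m : ℤ in atBot, sojourn I ω m ≤ -(4 * ε * m) + b - 3 * ε := by
  obtain ⟨K, hK⟩ := eventually_atBot.1 (hI.eventually_pathWeight_le hω hε)
  filter_upwards [eventually_add_one_atBot (hI.eventually_abs_le hε),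
    eventually_add_one_atBot (hω.eventually_abs_le hε),
    eventually_le_atBot 0, eventually_le_atBot K] with m h1 h2 h3 h4
  unfold sojourn
  rw [sub_le_iff_le_add]
  apply heightOut_le
  intro k hk
  have h5 := hK k (hk.trans h4)
  rw [pathWeight_eq_add_sum I ω (by omega : k ≤ m + 1) h3] at h5
  rw [height_eq_neg_sum I h3]
  rw [abs_le] at h1 h2
  push_cast at h1 h2
  have hk' : (k : ℝ) ≤ m := by exact_mod_cast hk
  have h6 : (a - b - 2 * ε) * k ≤ (a - b - 2 * ε) * m :=
    mul_le_mul_of_nonneg_left hk' (by linarith)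
  linarith [h1.2, h2.1]

lemma sum_departure (I ω : BiSeq) {m : ℤ} (hm : m ≤ 1) :
    ∑ k ∈ Finset.Icc m 0, departure I ω k =
      ∑ k ∈ Finset.Icc m 0, I k + (sojourn I ω 0 - sojourn I ω (m - 1)) := by
  induction m, hm using Int.leInductionDown with
  | base => simp
  | pred m hm ih =>
    have e1 := sum_Icc_succ_left (departure I ω) (show m - 1 ≤ 0 by omega)
    have e2 := sum_Icc_succ_left I (show m - 1 ≤ 0 by omega)
    rw [sub_add_cancel] at e1 e2
    rw [e1, e2, ih, departure_eq_add_sojourn']; ring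

lemma HasAverage.tendsto_sojourn_div {I ω : BiSeq} {a b : ℝ} (hI : HasAverage I a)
    (hω : HasAverage ω b) (hab : b < a) :
    Tendsto (fun m : ℤ => |(m : ℝ)|⁻¹ * sojourn I ω (m - 1)) atBot (𝓝 0) := by
  have hf := (hI.stable hω hab).finiteQueue
  rw [Metric.tendsto_nhds]
  intro ε hε
  -- The first bound keeps `4 * δ * |m|` below a quarter of `ε * |m|`; the second is the slope
  -- condition `2 * δ ≤ a - b`.
  set δ := min (ε / 16) ((a - b) / 2)
  have hδ : 0 < δ := lt_min (by linarith) (by linarith)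
  have hδ1 : δ ≤ ε / 16 := min_le_left _ _
  have hδ2 : δ ≤ (a - b) / 2 := min_le_right _ _
  have h1 := (tendsto_atBot_add_const_right atBot (-1 : ℤ) tendsto_id).eventually
    (hI.eventually_sojourn_le hω hδ (by linarith))
  have h2 : ∀ᶠ m : ℤ in atBot, (m : ℝ) < -(2 * (|b| + ε) / ε) :=
    (tendsto_intCast_atBot_iff.2 tendsto_id).eventually (eventually_lt_atBot _)
  filter_upwards [h1, h2, eventually_lt_atBot 0] with m h1 h2 h3
  have hm0 : (m : ℝ) < 0 := by exact_mod_cast h3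
  have hJ : 0 ≤ sojourn I ω (m - 1) := (hω.nonneg _).trans (hf.le_sojourn _)
  rw [dist_zero_right, Real.norm_of_nonneg (by positivity), abs_of_neg hm0,
    inv_mul_lt_iff₀ (by linarith)]
  simp only [id] at h1
  rw [← sub_eq_add_neg] at h1
  push_cast at h1
  have h4 : 2 * (|b| + ε) < -m * ε := by
    rw [← div_lt_iff₀ hε]; linarith
  have h5 : δ * (-m) ≤ ε / 16 * (-m) := mul_le_mul_of_nonneg_right hδ1 (by linarith)
  linarith [le_abs_self b]

/-- The sums of departures and arrivals differ by a telescoping difference of sojourn times, which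
is sublinear. -/
lemma HasAverage.departure {I ω : BiSeq} {a b : ℝ} (hI : HasAverage I a)
    (hω : HasAverage ω b) (hab : b < a) : HasAverage (departure I ω) a := by
  have hf := (hI.stable hω hab).finiteQueue
  refine ⟨fun k => (hω.nonneg k).trans (hf.le_departure k), ?_⟩
  have h1 : Tendsto (fun m : ℤ => |(m : ℝ)|⁻¹ * sojourn I ω 0) atBot (𝓝 0) := by
    have : Tendsto (fun m : ℤ => |(m : ℝ)|⁻¹) atBot (𝓝 0) :=
      tendsto_inv_atTop_zero.comp
        (tendsto_abs_atBot_atTop.comp (tendsto_intCast_atBot_iff.2 tendsto_id))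
    simpa using this.mul_const (sojourn I ω 0)
  have h2 := (hI.tendsto.add h1).sub (hI.tendsto_sojourn_div hω hab)
  rw [add_zero, sub_zero] at h2
  refine h2.congr' ?_
  filter_upwards [eventually_le_atBot 1] with m hm
  simp only [leftAverage]
  rw [sum_departure I ω hm]; ring

/-- By `D + R = I + ω`, where `D` has the average of `I`. The services passed on therefore still
stabilise the next line. -/
lemma HasAverage.dualService {I ω : BiSeq} {a b : ℝ} (hI : HasAverage I a)
    (hω : HasAverage ω b) (hab : b < a) : HasAverage (dualService I ω) b := by
  have hf := (hI.stable hω hab).finiteQueue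
  refine ⟨hf.dualService_nonneg hI.nonneg hω.nonneg, ?_⟩
  have h2 := (hI.tendsto.add hω.tendsto).sub (hI.departure hω hab).tendsto
  rw [add_sub_cancel_left] at h2
  refine h2.congr fun m => ?_
  simp only [leftAverage]
  rw [← mul_add, ← mul_sub, ← Finset.sum_add_distrib, ← Finset.sum_sub_distrib]
  congr 1
  refine Finset.sum_congr rfl fun k _ => ?_
  have := hf.departure_add_dualService k
  linarith

lemma HasAverage.tandem {ζ : ℕ → BiSeq} {τ : ℕ → ℝ} (k : ℕ) (h : ∀ j ≤ k, HasAverage (ζ j) (τ j))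
    (hτ : ∀ j ≤ k, j ≠ 0 → τ j < τ 0) : HasAverage (tandem ζ k) (τ 0) := by
  induction k with
  | zero => exact h 0 le_rfl
  | succ k ih =>
    exact (ih (fun j hj => h j (by omega)) (fun j hj => hτ j (by omega))).departure
      (h _ le_rfl) (hτ _ le_rfl (by omega))

/-! ### Exponential distributions and their sequences -/

lemma expMean_eq {m : ℝ} (hm : 0 < m) : expMean m = expMeasure m⁻¹ := if_pos hm

lemma expMeasure_eq_withDensity (r : ℝ) :
    expMeasure r = volume.withDensity (exponentialPDF r) := rfl

lemma measurable_exponentialPDF (r : ℝ) : Measurable (exponentialPDF r) :=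
  (measurable_exponentialPDFReal r).ennreal_ofReal

lemma expMean_ae_nonneg (m : ℝ) : ∀ᵐ x ∂(expMean m), 0 ≤ x := by
  unfold expMean
  split_ifs with hm
  · rw [expMeasure_eq_withDensity, ae_withDensity_iff (measurable_exponentialPDF _)]
    refine ae_of_all _ fun x hx => ?_
    by_contra hneg
    exact hx (exponentialPDF_of_neg (not_le.1 hneg))
  · rw [ae_dirac_iff measurableSet_Ici]

lemma lintegral_expMean {m : ℝ} (hm : 0 < m) :
    ∫⁻ x, ENNReal.ofReal x ∂(expMean m) = ENNReal.ofReal m := by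
  rw [expMean_eq hm, expMeasure_eq_withDensity,
    lintegral_withDensity_eq_lintegral_mul _ (measurable_exponentialPDF _) (by fun_prop)]
  have hr : 0 < m⁻¹ := inv_pos.2 hm
  -- Multiplying the exponential density by `x` gives `m` times the Gamma density of shape `2`,
  -- whose total mass is known.
  have e : ∀ x, (exponentialPDF m⁻¹ * fun x => ENNReal.ofReal x) x =
      ENNReal.ofReal m * gammaPDF 2 m⁻¹ x := by
    intro x
    rcases lt_or_ge x 0 with hx | hx
    · simp [exponentialPDF_of_neg hx, gammaPDF_of_neg hx]
    · simp only [Pi.mul_apply]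
      rw [exponentialPDF_of_nonneg hx, gammaPDF_of_nonneg hx, ← ENNReal.ofReal_mul (by positivity),
        ← ENNReal.ofReal_mul hm.le]
      congr 1
      have e1 : (m⁻¹ : ℝ) ^ (2 : ℝ) = m⁻¹ * m⁻¹ := by
        rw [show (2 : ℝ) = ((2 : ℕ) : ℝ) by norm_num, Real.rpow_natCast]; ring
      rw [show (2 : ℝ) - 1 = 1 by norm_num, Real.rpow_one, Real.Gamma_two, e1]
      field_simp
  simp_rw [e]
  rw [lintegral_const_mul _ (by exact (measurable_gammaPDFReal 2 _).ennreal_ofReal),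
    lintegral_gammaPDF_eq_one (by norm_num) hr, mul_one]

lemma integrable_expMean {m : ℝ} (hm : 0 < m) : Integrable (fun x => x) (expMean m) := by
  refine ⟨by fun_prop, ?_⟩
  rw [hasFiniteIntegral_iff_ofReal (expMean_ae_nonneg m), lintegral_expMean hm]
  exact ENNReal.ofReal_lt_top

lemma integral_expMean {m : ℝ} (hm : 0 < m) : ∫ x, x ∂(expMean m) = m := by
  rw [integral_eq_lintegral_of_nonneg_ae (expMean_ae_nonneg m) (by fun_prop),
    lintegral_expMean hm, ENNReal.toReal_ofReal hm.le]

lemma expMean_Ioi_pos {m : ℝ} (hm : 0 < m) (c : ℝ) : 0 < expMean m (Set.Ioi c) := by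
  rw [pos_iff_ne_zero]
  intro h0
  have hr : 0 < m⁻¹ := inv_pos.2 hm
  rw [expMean_eq hm, expMeasure_eq_withDensity] at h0
  rw [withDensity_apply _ measurableSet_Ioi,
    lintegral_eq_zero_iff (measurable_exponentialPDF _)] at h0
  have h1 : ∀ᵐ x ∂(volume.restrict (Set.Ioi (max c 0))), False := by
    have h2 := ae_restrict_of_ae_restrict_of_subset (Set.Ioi_subset_Ioi (le_max_left c 0)) h0
    filter_upwards [h2, ae_restrict_mem measurableSet_Ioi] with x hx hx'
    have hx0 : 0 < x := lt_of_le_of_lt (le_max_right _ _) hx'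
    rw [Pi.zero_apply, exponentialPDF_of_nonneg hx0.le, ENNReal.ofReal_eq_zero] at hx
    have : 0 < m⁻¹ * Real.exp (-(m⁻¹ * x)) := by positivity
    linarith
  rw [ae_iff] at h1
  simp at h1

lemma measurePreserving_eval_expSeq (m : ℝ) (k : ℤ) :
    MeasurePreserving (fun x : BiSeq => x k) (expSeq m) (expMean m) :=
  measurePreserving_eval_infinitePi (fun _ : ℤ => expMean m) k

lemma integrable_expSeq {m : ℝ} (hm : 0 < m) (k : ℤ) :
    Integrable (fun x : BiSeq => x k) (expSeq m) :=
  (measurePreserving_eval_expSeq m k).integrable_comp_of_integrable (integrable_expMean hm)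

lemma integral_expSeq {m : ℝ} (hm : 0 < m) (k : ℤ) : ∫ x : BiSeq, x k ∂(expSeq m) = m := by
  have h := integral_map (μ := expSeq m) (φ := fun x : BiSeq => x k) (f := fun y : ℝ => y)
    (measurable_pi_apply k).aemeasurable (by fun_prop)
  rw [(measurePreserving_eval_expSeq m k).map_eq, integral_expMean hm] at h
  exact h.symm

lemma expSeq_ae_nonneg (m : ℝ) : ∀ᵐ x ∂(expSeq m), ∀ k, 0 ≤ x k := by
  rw [ae_all_iff]
  intro k
  exact (measurePreserving_eval_expSeq m k).quasiMeasurePreserving.ae (expMean_ae_nonneg m)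

lemma tendsto_atBot_of_tendsto_neg_natCast {α : Type*} {F : Filter α} {f : ℤ → α}
    (h : Tendsto (fun n : ℕ => f (-n)) atTop F) : Tendsto f atBot F := by
  have h1 : Tendsto (fun m : ℤ => f (-m)) atTop F := by
    rw [← Nat.map_cast_int_atTop, tendsto_map'_iff]
    exact h
  simpa [Function.comp_def] using h1.comp tendsto_neg_atBot_atTop

lemma sum_Icc_neg_eq_sum_range (x : BiSeq) (n : ℕ) :
    ∑ k ∈ Finset.Icc (-n : ℤ) 0, x k = ∑ i ∈ Finset.range (n + 1), x (-i) := by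
  induction n with
  | zero => simp
  | succ n ih =>
    rw [Finset.sum_range_succ, ← ih, sum_Icc_succ_left x (by push_cast; omega), add_comm]
    congr 3
    push_cast
    ring

lemma expSeq_ae_hasAverage {m : ℝ} (hm : 0 < m) : ∀ᵐ x ∂(expSeq m), HasAverage x m := by
  have hind : iIndepFun (fun (k : ℤ) (x : BiSeq) => x k) (expSeq m) :=
    iIndepFun_infinitePi (P := fun _ : ℤ => expMean m) (X := fun _ y => y) fun _ => measurable_id
  have h := strong_law_ae_real (μ := expSeq m) (fun (n : ℕ) (x : BiSeq) => x (-n))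
    (integrable_expSeq hm _) (fun i j hij => hind.indepFun (by simpa using hij))
    (fun i => ⟨(measurable_pi_apply _).aemeasurable, (measurable_pi_apply _).aemeasurable,
      ((measurePreserving_eval_expSeq m _).map_eq).trans
        (measurePreserving_eval_expSeq m _).map_eq.symm⟩)
  filter_upwards [h, expSeq_ae_nonneg m] with x hx hx0
  refine ⟨hx0, tendsto_atBot_of_tendsto_neg_natCast ?_⟩
  rw [integral_expSeq hm] at hx
  have h1 := (hx.comp (tendsto_add_atTop_nat 1)).mul
    ((tendsto_natCast_div_add_atTop (1 : ℝ)).inv₀ one_ne_zero)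
  rw [inv_one, mul_one] at h1
  refine h1.congr' ?_
  filter_upwards [eventually_gt_atTop 0] with n hn
  have hn' : (n : ℝ) ≠ 0 := by positivity
  simp only [leftAverage, Function.comp]
  rw [sum_Icc_neg_eq_sum_range]
  push_cast
  rw [abs_neg, Nat.abs_cast]
  field_simp

/-! ### Modifying one coordinate of a product -/

lemma measurePreserving_update {ι E : Type*} [Countable ι] [DecidableEq ι] [MeasurableSpace E]
    (μ : ι → Measure E) [∀ i, IsProbabilityMeasure (μ i)] (i : ι) :
    MeasurePreserving (fun p : (ι → E) × E => Function.update p.1 i p.2)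
      ((Measure.infinitePi μ).prod (μ i)) (Measure.infinitePi μ) := by
  have hm : Measurable (fun p : (ι → E) × E => Function.update p.1 i p.2) := by
    refine measurable_pi_lambda _ fun j => ?_
    by_cases h : j = i
    · subst h; simpa using measurable_snd
    · simp only [Function.update_of_ne h]; fun_prop
  refine ⟨hm, Measure.eq_infinitePi _ fun s t ht => ?_⟩
  rw [Measure.map_apply hm (MeasurableSet.pi s.countable_toSet fun j _ => ht j)]
  by_cases hi : i ∈ s
  · have e : (fun p : (ι → E) × E => Function.update p.1 i p.2) ⁻¹' (Set.pi s t) =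
        (Set.pi (s.erase i : Finset ι) t) ×ˢ t i := by
      ext p
      simp only [Set.mem_preimage, Set.mem_pi, Finset.mem_coe, Set.mem_prod, Finset.mem_erase]
      constructor
      · intro h
        refine ⟨fun j hj => ?_, ?_⟩
        · simpa [Function.update_of_ne hj.1] using h j hj.2
        · simpa using h i hi
      · rintro ⟨h1, h2⟩ j hj
        by_cases hji : j = i
        · subst hji; simpa using h2
        · simpa [Function.update_of_ne hji] using h1 j ⟨hji, hj⟩
    rw [e, Measure.prod_prod, Measure.infinitePi_pi μ (fun j _ => ht j), Finset.prod_erase_mul _ _ hi]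
  · have e : (fun p : (ι → E) × E => Function.update p.1 i p.2) ⁻¹' (Set.pi s t) =
        (Set.pi s t) ×ˢ Set.univ := by
      ext p
      simp only [Set.mem_preimage, Set.mem_pi, Finset.mem_coe, Set.mem_prod, Set.mem_univ, and_true]
      refine forall₂_congr fun j hj => ?_
      rw [Function.update_of_ne (by rintro rfl; exact hi hj)]
    rw [e, Measure.prod_prod, Measure.infinitePi_pi μ (fun j _ => ht j), measure_univ, mul_one]

lemma measurable_update_step {ι E F : Type*} [DecidableEq ι] [MeasurableSpace E]
    [MeasurableSpace F] {g : E × F → E × F} (hg : Measurable g) (i : ι) :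
    Measurable (fun p : (ι → E) × F =>
      (Function.update p.1 i (g (p.1 i, p.2)).1, (g (p.1 i, p.2)).2)) := by
  have h0 : Measurable (fun p : (ι → E) × F => g (p.1 i, p.2)) := hg.comp (by fun_prop)
  refine Measurable.prodMk (measurable_pi_lambda _ fun j => ?_) h0.snd
  by_cases h : j = i
  · subst h; simpa using h0.fst
  · simp only [Function.update_of_ne h]; fun_prop

/-- Let `g` act on the `i`-th coordinate of an independent family together with an independent
auxiliary variable. If `g` preserves their joint law, then it preserves the law of everything. -/
lemma measurePreserving_update_step {ι E F : Type*} [Countable ι] [DecidableEq ι]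
    [MeasurableSpace E] [MeasurableSpace F]
    (μ : ι → Measure E) [∀ i, IsProbabilityMeasure (μ i)] (ν : Measure F) [IsProbabilityMeasure ν]
    (i : ι) {g : E × F → E × F} (hg : MeasurePreserving g ((μ i).prod ν) ((μ i).prod ν)) :
    MeasurePreserving (fun p : (ι → E) × F =>
      (Function.update p.1 i (g (p.1 i, p.2)).1, (g (p.1 i, p.2)).2))
      ((Measure.infinitePi μ).prod ν) ((Measure.infinitePi μ).prod ν) := by
  have hF := measurable_update_step hg.measurable i
  set U : ((ι → E) × E) × F → (ι → E) × F :=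
    Prod.map (fun p : (ι → E) × E => Function.update p.1 i p.2) id
  have hU : MeasurePreserving U (((Measure.infinitePi μ).prod (μ i)).prod ν)
      ((Measure.infinitePi μ).prod ν) := (measurePreserving_update μ i).prod (.id ν)
  have hA := measurePreserving_prodAssoc (Measure.infinitePi μ) (μ i) ν
  have hB := hA.symm.comp (((MeasurePreserving.id (Measure.infinitePi μ)).prod hg).comp hA)
  refine ⟨hF, ?_⟩
  -- The family is realised by overwriting coordinate `i` with an independent copy. Then `g` acts on
  -- the copy and the auxiliary variable alone, where it preserves the law.
  conv_lhs => rw [← hU.map_eq]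
  rw [Measure.map_map hF hU.measurable, ← (hU.comp hB).map_eq]
  congr 1
  funext p
  obtain ⟨⟨x, y⟩, r⟩ := p
  simp [U, Function.comp_def, MeasurableEquiv.prodAssoc]

/-- Exchanging the first two factors of a triple product. -/
lemma measurePreserving_prod_left_comm {α β γ : Type*} [MeasurableSpace α] [MeasurableSpace β]
    [MeasurableSpace γ] (μ : Measure α) (ν : Measure β) (τ : Measure γ) [SFinite μ] [SFinite ν]
    [SFinite τ] :
    MeasurePreserving (fun p : α × β × γ => (p.2.1, p.1, p.2.2)) (μ.prod (ν.prod τ))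
      (ν.prod (μ.prod τ)) :=
  (measurePreserving_prodAssoc ν μ τ).comp
    (((Measure.measurePreserving_swap (μ := μ) (ν := ν)).prod (.id τ)).comp
      (measurePreserving_prodAssoc μ ν τ).symm)

lemma measurePreserving_withDensity_of_comp_eq {α : Type*} [MeasurableSpace α] {μ : Measure α}
    {f : α → ENNReal} (hf : Measurable f) {φ : α → α} (hφ : MeasurePreserving φ μ μ)
    (h : ∀ x, f (φ x) = f x) : MeasurePreserving φ (μ.withDensity f) (μ.withDensity f) := by
  refine ⟨hφ.measurable, Measure.ext fun s hs => ?_⟩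
  rw [Measure.map_apply hφ.measurable hs, withDensity_apply _ hs,
    withDensity_apply _ (hφ.measurable hs), ← hφ.setLIntegral_comp_preimage hs hf]
  exact setLIntegral_congr_fun (hφ.measurable hs) fun x _ => (h x).symm

/-! ### Burke's theorem for one customer -/

/-- `(I, (ω, J)) ↦ (D, (R, J'))`. -/
def queueStep (p : ℝ × ℝ × ℝ) : ℝ × ℝ × ℝ :=
  (p.2.1 + max (p.1 - p.2.2) 0, min p.1 p.2.2, p.2.1 + max (p.2.2 - p.1) 0)

lemma measurable_queueStep : Measurable queueStep := by
  unfold queueStep; fun_prop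

lemma measurePreserving_add_left_of_prod {α : Type*} [MeasurableSpace α] (μ : Measure α)
    [SFinite μ] {f : α → ℝ} (hf : Measurable f) :
    MeasurePreserving (fun p : α × ℝ => (p.1, f p.1 + p.2)) (μ.prod volume) (μ.prod volume) :=
  (MeasurePreserving.id μ).skew_product (g := fun a x => f a + x) (by fun_prop)
    (ae_of_all _ fun a => (measurePreserving_add_left volume (f a)).map_eq)

/-- The map is linear on each of the regions `J < I` and `I ≤ J`. Each linear piece preserves volume
on the whole space, and a point lies in the region of its piece exactly when its image does. -/
lemma measurePreserving_queueStep_volume :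
    MeasurePreserving queueStep ((volume : Measure ℝ).prod ((volume : Measure ℝ).prod volume))
      ((volume : Measure ℝ).prod ((volume : Measure ℝ).prod volume)) := by
  set V := (volume : Measure ℝ).prod ((volume : Measure ℝ).prod (volume : Measure ℝ))
  have hA : MeasurePreserving (fun p : ℝ × ℝ × ℝ => (p.2.1 - p.2.2 + p.1, (p.2.2, p.2.1))) V V :=
    (((MeasurePreserving.id volume).prod (Measure.measurePreserving_swap)).comp
      (Measure.measurePreserving_swap)).comp
      ((measurePreserving_add_left_of_prod ((volume : Measure ℝ).prod (volume : Measure ℝ))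
        (f := fun q => q.1 - q.2) (by fun_prop)).comp Measure.measurePreserving_swap)
  have hB : MeasurePreserving (fun p : ℝ × ℝ × ℝ => (p.2.1, (p.1, p.2.1 - p.1 + p.2.2))) V V :=
    (measurePreserving_prod_left_comm (volume : Measure ℝ) (volume : Measure ℝ) volume).comp
      ((measurePreserving_prodAssoc (volume : Measure ℝ) (volume : Measure ℝ) volume).comp
      ((measurePreserving_add_left_of_prod ((volume : Measure ℝ).prod (volume : Measure ℝ))
        (f := fun q => q.2 - q.1) (by fun_prop)).comp
      (measurePreserving_prodAssoc (volume : Measure ℝ) (volume : Measure ℝ) volume).symm))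
  refine ⟨measurable_queueStep, Measure.ext fun s hs => ?_⟩
  rw [Measure.map_apply measurable_queueStep hs]
  set P : Set (ℝ × ℝ × ℝ) := {p | p.2.2 < p.1}
  have hP : MeasurableSet P := measurableSet_lt (by fun_prop) (by fun_prop)
  set Q : Set (ℝ × ℝ × ℝ) := {p | p.2.2 < p.1}
  have e1 : queueStep ⁻¹' s ∩ P =
      (fun p : ℝ × ℝ × ℝ => (p.2.1 - p.2.2 + p.1, (p.2.2, p.2.1))) ⁻¹' (s ∩ P) := by
    ext ⟨i, w, j⟩
    simp only [Set.mem_inter_iff, Set.mem_preimage, P, Set.mem_ofPred_eq, queueStep]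
    constructor
    · rintro ⟨h1, h2⟩
      rw [max_eq_left (by linarith), max_eq_right (by linarith), min_eq_right h2.le] at h1
      refine ⟨?_, by linarith⟩
      convert h1 using 2
      · ring
      · simp
    · rintro ⟨h1, h2⟩
      have h2 : j < i := by linarith
      rw [max_eq_left (by linarith), max_eq_right (by linarith), min_eq_right h2.le]
      refine ⟨?_, h2⟩
      convert h1 using 2
      · ring
      · simp
  have e2 : queueStep ⁻¹' s \ P =
      (fun p : ℝ × ℝ × ℝ => (p.2.1, (p.1, p.2.1 - p.1 + p.2.2))) ⁻¹' (s \ P) := by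
    ext ⟨i, w, j⟩
    simp only [Set.mem_sdiff, Set.mem_preimage, P, Set.mem_ofPred_eq, queueStep, not_lt]
    constructor
    · rintro ⟨h1, h2⟩
      rw [max_eq_right (by linarith), max_eq_left (by linarith), min_eq_left h2] at h1
      refine ⟨?_, by linarith⟩
      convert h1 using 2
      · simp
      · congr 1; ring
    · rintro ⟨h1, h2⟩
      have h2 : i ≤ j := by linarith
      rw [max_eq_right (by linarith), max_eq_left (by linarith), min_eq_left h2]
      refine ⟨?_, h2⟩
      convert h1 using 2
      · simp
      · congr 1; ring
  rw [← measure_inter_add_sdiff (queueStep ⁻¹' s) hP, e1, e2,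
    hA.measure_preimage (hs.inter hP).nullMeasurableSet,
    hB.measure_preimage (hs.diff hP).nullMeasurableSet, measure_inter_add_sdiff s hP]

/-- The middle rate `a + b` makes the joint density a function of `i + w` and `j + w` alone, and
`queueStep` preserves these two sums: `D + R = I + ω` and `J' + R = J + ω`. -/
lemma exponentialPDF_prod_eq {a b i w j : ℝ} (ha : 0 < a) (hb : 0 < b) (hi : 0 ≤ i) (hw : 0 ≤ w)
    (hj : 0 ≤ j) :
    exponentialPDF a i * (exponentialPDF (a + b) w * exponentialPDF b j) =
      ENNReal.ofReal (a * ((a + b) * b) * Real.exp (-(a * (i + w) + b * (j + w)))) := by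
  rw [exponentialPDF_of_nonneg hi, exponentialPDF_of_nonneg hw, exponentialPDF_of_nonneg hj,
    ← ENNReal.ofReal_mul (by positivity), ← ENNReal.ofReal_mul (by positivity)]
  congr 1
  rw [show -(a * (i + w) + b * (j + w)) = -(a * i) + (-((a + b) * w) + -(b * j)) by ring,
    Real.exp_add, Real.exp_add]
  ring

lemma exponentialPDF_prod_eq_zero {a b c i w j : ℝ} (h : ¬ (0 ≤ i ∧ 0 ≤ w ∧ 0 ≤ j)) :
    exponentialPDF a i * (exponentialPDF c w * exponentialPDF b j) = 0 := by
  by_cases hi : 0 ≤ i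
  · by_cases hw : 0 ≤ w
    · rw [exponentialPDF_of_neg (x := j) (not_le.1 fun hj => h ⟨hi, hw, hj⟩)]; simp
    · rw [exponentialPDF_of_neg (x := w) (not_le.1 hw)]; simp
  · rw [exponentialPDF_of_neg (x := i) (not_le.1 hi)]; simp

/-- Exponential variables `(I, (ω, J))` with rates `(a, (a + b, b))` are mapped by the queueing
recursion to `(D, (R, J'))` with the same joint law. -/
lemma measurePreserving_queueStep {a b : ℝ} (ha : 0 < a) (hb : 0 < b) :
    MeasurePreserving queueStep
      ((expMeasure a).prod ((expMeasure (a + b)).prod (expMeasure b)))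
      ((expMeasure a).prod ((expMeasure (a + b)).prod (expMeasure b))) := by
  simp only [expMeasure_eq_withDensity]
  have hm := measurable_exponentialPDF
  rw [prod_withDensity (hm _) (hm _), prod_withDensity (hm _) (by fun_prop)]
  refine measurePreserving_withDensity_of_comp_eq (by fun_prop)
    measurePreserving_queueStep_volume ?_
  rintro ⟨i, w, j⟩
  simp only [queueStep]
  rcases le_total i j with hij | hij
  · rw [max_eq_right (by linarith), max_eq_left (by linarith), min_eq_left hij]
    by_cases h : 0 ≤ i ∧ 0 ≤ w ∧ 0 ≤ j
    · obtain ⟨hi, hw, hj⟩ := h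
      rw [exponentialPDF_prod_eq ha hb (by linarith) hi (by linarith),
        exponentialPDF_prod_eq ha hb hi hw hj]
      congr 3; ring
    · rw [exponentialPDF_prod_eq_zero h, exponentialPDF_prod_eq_zero]
      rintro ⟨h1, h2, h3⟩
      exact h ⟨h2, by linarith, by linarith⟩
  · rw [max_eq_left (by linarith), max_eq_right (by linarith), min_eq_right hij]
    by_cases h : 0 ≤ i ∧ 0 ≤ w ∧ 0 ≤ j
    · obtain ⟨hi, hw, hj⟩ := h
      rw [exponentialPDF_prod_eq ha hb (by linarith) hj (by linarith),
        exponentialPDF_prod_eq ha hb hi hw hj]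
      congr 3; ring
    · rw [exponentialPDF_prod_eq_zero h, exponentialPDF_prod_eq_zero]
      rintro ⟨h1, h2, h3⟩
      exact h ⟨by linarith, by linarith, h2⟩

/-! ### Burke's theorem for bi-infinite sequences -/

/-- Process customer `k`, the previous sojourn time being the last component. -/
def burkeStep (k : ℤ) (p : BiSeq × BiSeq × ℝ) : BiSeq × BiSeq × ℝ :=
  let q := queueStep (p.1 k, p.2.1 k, p.2.2)
  (Function.update p.1 k q.1, Function.update p.2.1 k q.2.1, q.2.2)

lemma measurePreserving_burkeStep {a b : Measure ℝ} {c : Measure ℝ} [IsProbabilityMeasure a]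
    [IsProbabilityMeasure b] [IsProbabilityMeasure c]
    (h : MeasurePreserving queueStep (a.prod (b.prod c)) (a.prod (b.prod c))) (k : ℤ) :
    MeasurePreserving (burkeStep k)
      ((Measure.infinitePi fun _ : ℤ => a).prod ((Measure.infinitePi fun _ : ℤ => b).prod c))
      ((Measure.infinitePi fun _ : ℤ => a).prod ((Measure.infinitePi fun _ : ℤ => b).prod c)) := by
  have h2 := (measurePreserving_prod_left_comm a b c).comp
    (h.comp (measurePreserving_prod_left_comm b a c))
  have h3 := measurePreserving_update_step (fun _ : ℤ => b) (a.prod c) k h2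
  have h4 := (measurePreserving_prod_left_comm (Measure.infinitePi fun _ : ℤ => b) a c).comp
    (h3.comp (measurePreserving_prod_left_comm a (Measure.infinitePi fun _ : ℤ => b) c))
  exact measurePreserving_update_step (fun _ : ℤ => a) _ k h4

/-- Process the customers `m + 1, …, m + j`. -/
def burkeChain (m : ℤ) : ℕ → BiSeq × BiSeq × ℝ → BiSeq × BiSeq × ℝ
  | 0 => id
  | j + 1 => burkeStep (m + j + 1) ∘ burkeChain m j

/-- Sojourn time of customer `m + j` if that of customer `m` is prescribed. -/
def sojournFrom (p : BiSeq × BiSeq × ℝ) (m : ℤ) : ℕ → ℝ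
  | 0 => p.2.2
  | j + 1 => p.2.1 (m + j + 1) + max (sojournFrom p m j - p.1 (m + j + 1)) 0

lemma burkeChain_of_lt (p : BiSeq × BiSeq × ℝ) (m : ℤ) (j : ℕ) :
    (∀ k, m + j < k → (burkeChain m j p).1 k = p.1 k ∧ (burkeChain m j p).2.1 k = p.2.1 k) ∧
      (burkeChain m j p).2.2 = sojournFrom p m j := by
  induction j with
  | zero => exact ⟨fun k _ => ⟨rfl, rfl⟩, rfl⟩
  | succ j ih =>
    obtain ⟨ih1, ih2⟩ := ih
    have h := ih1 (m + j + 1) (by omega)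
    refine ⟨fun k hk => ?_, ?_⟩
    · push_cast at hk
      have hk' : k ≠ m + j + 1 := by omega
      simp only [burkeChain, burkeStep, Function.comp, Function.update_of_ne hk']
      exact ih1 k (by omega)
    · simp only [burkeChain, burkeStep, Function.comp, queueStep, sojournFrom, h.1, h.2, ih2]

lemma burkeChain_of_mem (p : BiSeq × BiSeq × ℝ) (m : ℤ) {i j : ℕ} (h : i < j) :
    (burkeChain m j p).1 (m + i + 1) =
        p.2.1 (m + i + 1) + max (p.1 (m + i + 1) - sojournFrom p m i) 0 ∧
      (burkeChain m j p).2.1 (m + i + 1) = min (p.1 (m + i + 1)) (sojournFrom p m i) := by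
  induction j with
  | zero => omega
  | succ j ih =>
    by_cases hij : i = j
    · subst hij
      obtain ⟨h1, h2⟩ := burkeChain_of_lt p m i
      have h3 := h1 (m + i + 1) (by omega)
      simp [burkeChain, burkeStep, queueStep, h3.1, h3.2, h2]
    · have hne : m + (i : ℤ) + 1 ≠ m + j + 1 := by omega
      simp only [burkeChain, burkeStep, Function.comp, Function.update_of_ne hne]
      exact ih (by omega)

/-- Until its first idle moment the started queue carries `c` plus the accumulated net work;
afterwards it is dominated by the stationary queue. -/
lemma FiniteQueue.sojournFrom_le {I ω : BiSeq} (h : FiniteQueue I ω) (c : ℝ) (m : ℤ) (j : ℕ) :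
    sojournFrom (I, ω, c) m j ≤
      max (sojourn I ω (m + j)) (c + ∑ i ∈ Finset.Icc (m + 1) (m + j), (ω i - I i)) := by
  induction j with
  | zero => simp [sojournFrom]
  | succ j ih =>
    push_cast
    simp only [sojournFrom, ← add_assoc]
    rw [sum_Icc_succ_right (fun i => ω i - I i) (by omega), h.sojourn_succ]
    rcases le_max_iff.1 ih with h1 | h1
    · apply le_max_of_le_left
      gcongr
    · rcases le_total (sojournFrom (I, ω, c) m j) (I (m + j + 1)) with h2 | h2
      · apply le_max_of_le_left
        rw [max_eq_right (by linarith)]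
        gcongr
        exact le_max_right _ _
      · apply le_max_of_le_right
        rw [max_eq_left (by linarith)]
        linarith

lemma pathWeight_le_sojournFrom (I ω : BiSeq) (c : ℝ) (m : ℤ) (j : ℕ) :
    ∀ k, m < k → k ≤ m + j →
      pathWeight I ω (m + j) k - height I (m + j) ≤ sojournFrom (I, ω, c) m j := by
  induction j with
  | zero => intro k h1 h2; push_cast at h2; omega
  | succ j ih =>
    intro k h1 h2
    push_cast at h2 ⊢
    rw [← add_assoc] at h2 ⊢
    simp only [sojournFrom]
    rcases eq_or_lt_of_le h2 with rfl | h2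
    · rw [pathWeight_self]
      linarith [le_max_right (sojournFrom (I, ω, c) m j - I (m + j + 1)) 0]
    · have := ih k h1 (by omega)
      rw [pathWeight_succ I ω (by omega), height_succ]
      linarith [le_max_left (sojournFrom (I, ω, c) m j - I (m + j + 1)) 0]

/-- The queue started from an arbitrary state in the remote past has coalesced with the stationary
one. -/
lemma Stable.eventually_sojournFrom_eq {I ω : BiSeq} (h : Stable I ω) (hω : ∀ k, 0 ≤ ω k) (c : ℝ)
    (l : ℤ) : ∀ᶠ N : ℕ in atTop, ∀ j : ℕ, -(N : ℤ) + j = l →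
      sojournFrom (I, ω, c) (-(N : ℤ)) j = sojourn I ω l := by
  have hf := h.finiteQueue
  have h1 : Tendsto (fun N : ℕ => -(N : ℤ)) atTop atBot :=
    tendsto_neg_atTop_atBot.comp tendsto_natCast_atTop_atTop
  -- The first threshold makes the contribution of the initial value `c` at most `ω l`; the second
  -- makes paths starting at or before the initial customer lighter than the one-point path at `l`.
  have h2 := (h.tendsto_pathWeight l).eventually_le_atBot
    (min (height I l + ω l - c) (height I l + ω l))
  obtain ⟨K, hK⟩ := eventually_atBot.1 h2
  filter_upwards [h1.eventually (eventually_le_atBot K), h1.eventually (eventually_lt_atBot l)]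
    with N hN hN' j hj
  generalize -(N : ℤ) = m at *
  subst hj
  apply le_antisymm
  · refine (hf.sojournFrom_le c m j).trans (max_le le_rfl ?_)
    have h3 := (hK m hN).trans (min_le_left _ _)
    have h4 := height_eq_add_sum I hN'.le
    have h5 := sum_Icc_succ_left ω hN'.le
    have h6 := hf.le_sojourn (m + j)
    have h7 := hω m
    unfold pathWeight at h3
    rw [Finset.sum_sub_distrib]
    linarith
  · unfold sojourn
    rw [sub_le_iff_le_add]
    apply heightOut_le
    intro k hk
    rcases le_or_gt k m with hkm | hkm
    · have h3 := (hK k (hkm.trans hN)).trans (min_le_right _ _)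
      have h4 := pathWeight_le_sojournFrom I ω c m j (m + j) hN' le_rfl
      rw [pathWeight_self] at h4
      linarith
    · have := pathWeight_le_sojournFrom I ω c m j k hkm hk
      linarith

lemma Stable.eventually_burkeChain_eq {I ω : BiSeq} (h : Stable I ω) (hω : ∀ k, 0 ≤ ω k) (c : ℝ)
    (l : ℤ) : ∀ᶠ N : ℕ in atTop,
      (burkeChain (-(N : ℤ)) (2 * N) (I, ω, c)).1 l = departure I ω l ∧
      (burkeChain (-(N : ℤ)) (2 * N) (I, ω, c)).2.1 l = dualService I ω l := by
  have hf := h.finiteQueue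
  filter_upwards [h.eventually_sojournFrom_eq hω c (l - 1), eventually_gt_atTop l.natAbs]
    with N hN hN'
  obtain ⟨i, hi⟩ : ∃ i : ℕ, -(N : ℤ) + i + 1 = l := ⟨(l - 1 + N).toNat, by omega⟩
  have h1 := hN i (by omega)
  obtain ⟨h2, h3⟩ := burkeChain_of_mem (I, ω, c) (-(N : ℤ)) (show i < 2 * N by omega)
  have h4 := hf.departure_succ (l - 1)
  rw [sub_add_cancel] at h4
  rw [hi, h1] at h2 h3
  exact ⟨h2.trans h4.symm, h3⟩

lemma Stable.tendsto_burkeChain {I ω : BiSeq} (h : Stable I ω) (hω : ∀ k, 0 ≤ ω k) (c : ℝ) :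
    Tendsto (fun N : ℕ => ((burkeChain (-(N : ℤ)) (2 * N) (I, ω, c)).1,
      (burkeChain (-(N : ℤ)) (2 * N) (I, ω, c)).2.1)) atTop
      (𝓝 (departure I ω, dualService I ω)) := by
  refine Tendsto.prodMk_nhds (tendsto_pi_nhds.2 fun l => ?_) (tendsto_pi_nhds.2 fun l => ?_)
  · refine tendsto_const_nhds.congr' ?_
    filter_upwards [h.eventually_burkeChain_eq hω c l] with N hN using hN.1.symm
  · refine tendsto_const_nhds.congr' ?_
    filter_upwards [h.eventually_burkeChain_eq hω c l] with N hN using hN.2.symm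

lemma measurable_dualService {α : Type*} [MeasurableSpace α] {f g : α → BiSeq}
    (hf : Measurable f) (hg : Measurable g) : Measurable (fun a => dualService (f a) (g a)) := by
  have h : ∀ l : ℤ, Measurable (fun a => sojourn (f a) (g a) l) := by
    intro l
    unfold sojourn heightOut height
    exact (Measurable.iSup fun k => by fun_prop).sub (by fun_prop)
  exact measurable_pi_lambda _ fun l => ((measurable_pi_apply l).comp hf).min (h (l - 1))

/-- Integrals of bounded continuous functions pass to the almost sure limit, and along the sequence
they are constant. -/
lemma map_eq_of_tendsto_of_measurePreserving {Ω E : Type*} [MeasurableSpace Ω] [TopologicalSpace E]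
    [MeasurableSpace E] [BorelSpace E] [HasOuterApproxClosed E] {P : Measure Ω}
    [IsProbabilityMeasure P] {ν : Measure E} {f : ℕ → Ω → E} {g : Ω → E}
    (hf : ∀ n, MeasurePreserving (f n) P ν) (hg : Measurable g)
    (h : ∀ᵐ x ∂P, Tendsto (fun n => f n x) atTop (𝓝 (g x))) : MeasurePreserving g P ν := by
  refine ⟨hg, ?_⟩
  have := Measure.isProbabilityMeasure_map (μ := P) hg.aemeasurable
  have : IsProbabilityMeasure ν := (hf 0).map_eq ▸
    Measure.isProbabilityMeasure_map (μ := P) (hf 0).measurable.aemeasurable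
  refine ext_of_forall_integral_eq_of_IsFiniteMeasure fun φ => ?_
  rw [integral_map hg.aemeasurable φ.continuous.measurable.aestronglyMeasurable]
  have h1 : Tendsto (fun n => ∫ x, φ (f n x) ∂P) atTop (𝓝 (∫ x, φ (g x) ∂P)) := by
    refine tendsto_integral_of_dominated_convergence (fun _ => ‖φ‖) (fun n => ?_)
      (integrable_const _) (fun n => ae_of_all _ fun x => φ.norm_coe_le_norm _) ?_
    · exact (φ.continuous.measurable.comp (hf n).measurable).aestronglyMeasurable
    · filter_upwards [h] with x hx
      exact (φ.continuous.tendsto _).comp hx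
  refine tendsto_nhds_unique h1 ?_
  refine tendsto_const_nhds.congr fun n => ?_
  rw [← (hf n).map_eq, integral_map (hf n).measurable.aemeasurable
    φ.continuous.measurable.aestronglyMeasurable]

lemma ae_prod_of_ae {α β : Type*} [MeasurableSpace α] [MeasurableSpace β] {μ : Measure α}
    {ν : Measure β} [SFinite ν] [SFinite μ] {p : α → Prop} {q : β → Prop} (hp : ∀ᵐ x ∂μ, p x)
    (hq : ∀ᵐ y ∂ν, q y) : ∀ᵐ z ∂(μ.prod ν), p z.1 ∧ q z.2 :=
  (Measure.quasiMeasurePreserving_fst.ae hp).and (Measure.quasiMeasurePreserving_snd.ae hq)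

/-- **Burke's theorem**: departures and dual services are independent, with the laws of the
arrivals and of the services. -/
theorem measurePreserving_burke {ρ s : ℝ} (hs : 0 < s) (hsρ : s < ρ) :
    MeasurePreserving (fun p : BiSeq × BiSeq => (departure p.1 p.2, dualService p.1 p.2))
      ((expSeq ρ).prod (expSeq s)) ((expSeq ρ).prod (expSeq s)) := by
  have hρ : 0 < ρ := hs.trans hsρ
  -- The auxiliary initial sojourn time has rate `s⁻¹ - ρ⁻¹`, so that the three rates have the form
  -- `(a, a + b, b)` required by `measurePreserving_queueStep`.
  have hb : 0 < s⁻¹ - ρ⁻¹ := sub_pos.2 (inv_strictAnti₀ hs hsρ)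
  have := isProbabilityMeasure_expMeasure hb
  have hstep := measurePreserving_queueStep (inv_pos.2 hρ) hb
  rw [add_sub_cancel, ← expMean_eq hρ, ← expMean_eq hs] at hstep
  have hm1 : Measurable (fun p : BiSeq × BiSeq => (departure p.1 p.2, dualService p.1 p.2)) :=
    (measurable_departure measurable_fst measurable_snd).prodMk
      (measurable_dualService measurable_fst measurable_snd)
  have hm2 : Measurable (fun p : BiSeq × BiSeq × ℝ =>
      (departure p.1 p.2.1, dualService p.1 p.2.1)) :=
    (measurable_departure measurable_fst measurable_snd.fst).prodMk
      (measurable_dualService measurable_fst measurable_snd.fst)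
  set M := (expSeq ρ).prod ((expSeq s).prod (expMeasure (s⁻¹ - ρ⁻¹)))
  have hchain : ∀ m j, MeasurePreserving (burkeChain m j) M M := by
    intro m j
    induction j with
    | zero => exact .id M
    | succ j ih => exact (measurePreserving_burkeStep hstep _).comp ih
  have hπ : MeasurePreserving (fun p : BiSeq × BiSeq × ℝ => (p.1, p.2.1)) M
      ((expSeq ρ).prod (expSeq s)) := (MeasurePreserving.id (expSeq ρ)).prod measurePreserving_fst
  have key : MeasurePreserving (fun p : BiSeq × BiSeq × ℝ =>
      (departure p.1 p.2.1, dualService p.1 p.2.1)) M ((expSeq ρ).prod (expSeq s)) := by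
    -- Customers `-N + 1, …, N` are processed from the auxiliary initial value; coalescence makes
    -- every coordinate eventually that of the stationary queue.
    refine map_eq_of_tendsto_of_measurePreserving
      (fun N : ℕ => hπ.comp (hchain (-(N : ℤ)) (2 * N))) hm2 ?_
    have h1 := hπ.quasiMeasurePreserving.ae
      (ae_prod_of_ae (expSeq_ae_hasAverage hρ) (expSeq_ae_hasAverage hs))
    filter_upwards [h1] with p hp
    exact (hp.1.stable hp.2 hsρ).tendsto_burkeChain hp.2.nonneg p.2.2
  refine ⟨hm1, ?_⟩
  conv_lhs => rw [← hπ.map_eq]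
  rw [Measure.map_map hm1 hπ.measurable]
  exact key.map_eq

/-! ### Passing the services through the lines of a multiqueue -/

/-- The services that enter line `j` when `ω` enters line `0`. -/
def passService {n : ℕ} (I : Config n) (ω : BiSeq) : ℕ → BiSeq
  | 0 => ω
  | j + 1 => if h : j < n then dualService (I ⟨j, h⟩) (passService I ω j) else passService I ω j

/-- The departures from the lines when `ω` enters line `0`. -/
def passDeparture {n : ℕ} (I : Config n) (ω : BiSeq) : Config n :=
  fun i => departure (I i) (passService I ω i)

lemma hasAverage_passService {n : ℕ} {I : Config n} {ω : BiSeq} {σ : Fin n → ℝ} {s : ℝ}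
    (hI : ∀ i, HasAverage (I i) (σ i)) (hω : HasAverage ω s) (hσ : ∀ i, s < σ i) (j : ℕ) :
    HasAverage (passService I ω j) s := by
  induction j with
  | zero => exact hω
  | succ j ih =>
    simp only [passService]
    split_ifs with h
    · exact (hI ⟨j, h⟩).dualService ih (hσ _)
    · exact ih

lemma hasAverage_multiqueue {n : ℕ} {I : Config n} {σ : Fin n → ℝ} (hσ : StrictMono σ)
    (hI : ∀ i, HasAverage (I i) (σ i)) (i : Fin n) : HasAverage (multiqueue I i) (σ i) := by
  have h := HasAverage.tandem (ζ := fun j => I ⟨i.val - j, lt_of_le_of_lt (Nat.sub_le _ _) i.isLt⟩)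
    (τ := fun j => σ ⟨i.val - j, lt_of_le_of_lt (Nat.sub_le _ _) i.isLt⟩) i.val
    (fun j _ => hI _) (fun j hj hj0 => hσ (by simp only [Fin.lt_def]; omega))
  exact h

/-- A step of the coupled process is the multiqueue map of the departures from the lines. -/
lemma coupledStep_multiqueue {n : ℕ} {I : Config n} {ω : BiSeq} {σ : Fin n → ℝ} {s : ℝ}
    (hσ : StrictMono σ) (hI : ∀ i, HasAverage (I i) (σ i)) (hω : HasAverage ω s)
    (hs : ∀ i, s < σ i) :
    coupledStep (multiqueue I) ω = multiqueue (passDeparture I ω) := by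
  funext i
  have hlt : ∀ j, i.val - j < n := fun j => lt_of_le_of_lt (Nat.sub_le _ _) i.isLt
  -- One use of `departure_departure` at line `i - (k + 1)` replaces this line by its departures and
  -- sends its dual services to line `i - k`, where the induction hypothesis takes over.
  have key : ∀ k ≤ i.val, departure (tandem (fun j => I ⟨i.val - j, hlt j⟩) k)
      (passService I ω (i.val - k)) =
        tandem (fun j => passDeparture I ω ⟨i.val - j, hlt j⟩) k := by
    intro k hk
    induction k with
    | zero => rfl
    | succ k ih =>
      have hk' : i.val - k = (i.val - (k + 1)) + 1 := by omega
      have e : passService I ω (i.val - k) =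
          dualService (I ⟨i.val - (k + 1), hlt _⟩) (passService I ω (i.val - (k + 1))) := by
        rw [hk', passService, dif_pos (hlt (k + 1))]
      have ht : HasAverage (tandem (fun j => I ⟨i.val - j, hlt j⟩) k) (σ ⟨i.val - 0, hlt 0⟩) :=
        HasAverage.tandem (ζ := fun j => I ⟨i.val - j, hlt j⟩) (τ := fun j => σ ⟨i.val - j, hlt j⟩)
          k (fun j _ => hI _) (fun j hj hj0 => hσ (by simp only [Fin.lt_def]; omega))
      have hI' := hI ⟨i.val - (k + 1), hlt (k + 1)⟩
      have hp := hasAverage_passService hI hω hs (i.val - (k + 1))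
      have hlt' : σ ⟨i.val - (k + 1), hlt (k + 1)⟩ < σ ⟨i.val - 0, hlt 0⟩ :=
        hσ (by simp only [Fin.lt_def]; omega)
      simp only [tandem]
      rw [departure_departure (ht.stable hI' hlt').finiteQueue (hI'.stable hp (hs _)).finiteQueue
        ((ht.departure hI' hlt').stable hp (hs _)).finiteQueue, ← e, ih (by omega)]
      rfl
  have h := key i.val le_rfl
  rw [Nat.sub_self] at h
  exact h

lemma nu_eq_infinitePi {n : ℕ} (σ : Fin n → ℝ) :
    nu σ = Measure.infinitePi fun i => expSeq (σ i) := (Measure.infinitePi_eq_pi _).symm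

instance {n : ℕ} (σ : Fin n → ℝ) : IsProbabilityMeasure (nu σ) := by unfold nu; infer_instance

lemma measurePreserving_passDeparture {n : ℕ} {σ : Fin n → ℝ} {s : ℝ} (hs : 0 < s)
    (hσ : ∀ i, s < σ i) :
    MeasurePreserving (fun p : Config n × BiSeq => passDeparture p.1 p.2)
      ((nu σ).prod (expSeq s)) (nu σ) := by
  -- After `j` lines, those below `j` are replaced by their departures and the others are untouched.
  -- By Burke's theorem for one line, the service about to enter line `j` remains independent of all
  -- of them.
  have key : ∀ j : ℕ, MeasurePreserving (fun p : Config n × BiSeq =>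
      ((fun i : Fin n => if i.val < j then departure (p.1 i) (passService p.1 p.2 i) else p.1 i :
        Config n), passService p.1 p.2 j)) ((nu σ).prod (expSeq s)) ((nu σ).prod (expSeq s)) := by
    intro j
    induction j with
    | zero =>
      simp only [passService, not_lt_zero, if_false]
      exact MeasurePreserving.id ((nu σ).prod (expSeq s))
    | succ j ih =>
      by_cases hj : j < n
      · have h1 := measurePreserving_update_step (fun i => expSeq (σ i)) (expSeq s) ⟨j, hj⟩
          (measurePreserving_burke hs (hσ ⟨j, hj⟩))
        rw [← nu_eq_infinitePi] at h1
        convert h1.comp ih using 1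
        funext p
        simp only [Function.comp, passService, hj, dif_pos, lt_irrefl, if_false]
        refine Prod.ext ?_ rfl
        funext i
        simp only
        by_cases hij : i = ⟨j, hj⟩
        · subst hij; simp
        · rw [Function.update_of_ne hij]
          have : i.val ≠ j := fun h => hij (Fin.ext h)
          congr 1
          exact propext (by omega)
      · convert ih using 1
        funext p
        simp only [passService, hj, dif_neg, not_false_eq_true]
        refine Prod.ext ?_ rfl
        funext i
        have := i.isLt
        simp only
        congr 1
        exact propext (by omega)
  convert (measurePreserving_fst (μ := nu σ) (ν := expSeq s)).comp (key n) using 1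
  funext p i
  simp [passDeparture]

lemma nu_ae_hasAverage {n : ℕ} {σ : Fin n → ℝ} (hσ : ∀ i, 0 < σ i) :
    ∀ᵐ I ∂(nu σ), ∀ i, HasAverage (I i) (σ i) := by
  rw [ae_all_iff]
  intro i
  exact (measurePreserving_eval (fun i => expSeq (σ i)) i).quasiMeasurePreserving.ae
    (expSeq_ae_hasAverage (hσ i))

/-! ### Translations -/

lemma measurable_shift (l : ℤ) : Measurable (shift l) :=
  measurable_pi_lambda _ fun k => measurable_pi_apply (k + l)

lemma measurable_translate {n : ℕ} (l : ℤ) : Measurable (translate l : Config n → Config n) :=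
  measurable_pi_lambda _ fun i => (measurable_shift l).comp (measurable_pi_apply i)

lemma translate_add {n : ℕ} (l m : ℤ) (η : Config n) :
    translate l (translate m η) = translate (l + m) η := by
  funext i k; simp [translate, add_assoc]

lemma translate_zero {n : ℕ} (η : Config n) : translate 0 η = η := by
  funext i k; simp [translate]

lemma tandem_shift (s : ℤ) (ζ : ℕ → BiSeq) (k : ℕ) :
    tandem (fun j => shift s (ζ j)) k = shift s (tandem ζ k) := by
  induction k with
  | zero => rfl
  | succ k ih => simp only [tandem, ih, departure_shift]

lemma multiqueue_translate {n : ℕ} (s : ℤ) (I : Config n) :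
    multiqueue (translate s I) = translate s (multiqueue I) :=
  funext fun _ => tandem_shift s _ _

lemma coupledStep_translate {n : ℕ} (s : ℤ) (η : Config n) (ω : BiSeq) :
    coupledStep (translate s η) (shift s ω) = translate s (coupledStep η ω) :=
  funext fun _ => departure_shift s _ _

lemma measurePreserving_shift_expSeq (m : ℝ) (s : ℤ) :
    MeasurePreserving (shift s) (expSeq m) (expSeq m) :=
  ⟨measurable_shift s, Measure.map_infinitePi_infinitePi_of_inj (P := fun _ : ℤ => expMean m)
    (f := fun k => k + s) (add_left_injective s)⟩

/-! ### Ergodicity of independent families -/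

/-- Approximate `A` by a cylinder `C` over a finite set `S`. The symmetry `e` moves `S` off itself,
so `C` and its preimage are independent, while both approximate the invariant set `A`. Thus `P(A)`
is arbitrarily close to `P(A)²`. -/
lemma measurableSet_eq_zero_or_one_of_forall_finset {ι : Type*} [Countable ι]
    (μ : ι → Measure ℝ) [∀ i, IsProbabilityMeasure (μ i)] {A : Set (ι → ℝ)} (hA : MeasurableSet A)
    (h : ∀ S : Finset ι, ∃ e : ι → ι, Function.Injective e ∧ (∀ i ∈ S, e i ∉ S) ∧
      (∀ i, μ (e i) = μ i) ∧ (fun (x : ι → ℝ) i => x (e i)) ⁻¹' A = A) :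
    Measure.infinitePi μ A = 0 ∨ Measure.infinitePi μ A = 1 := by
  classical
  set P := Measure.infinitePi μ
  have hind : iIndepFun (fun (i : ι) (x : ι → ℝ) => x i) P :=
    iIndepFun_infinitePi (X := fun _ y => y) fun _ => measurable_id
  have key : ∀ ε : ℝ, 0 < ε → |P.real A - P.real A ^ 2| ≤ 4 * ε := by
    intro ε hε
    obtain ⟨C, hC, hCA⟩ := exists_measure_symmDiff_lt_of_generateFrom_isSetRing (μ := P)
      (C := measurableCylinders fun _ : ι => ℝ) isSetAlgebra_measurableCylinders.isSetRing
      ⟨{Set.univ}, Set.countable_singleton _,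
        Set.singleton_subset_iff.2 isSetAlgebra_measurableCylinders.univ_mem, by simp⟩
      generateFrom_measurableCylinders.symm hA (ENNReal.ofReal_pos.2 hε)
    obtain ⟨S, B, hB, rfl⟩ := (mem_measurableCylinders C).1 hC
    obtain ⟨e, he, heS, heμ, heA⟩ := h S
    set C : Set (ι → ℝ) := cylinder (α := fun _ => ℝ) S B
    have hCm : MeasurableSet C := MeasurableSet.of_mem_measurableCylinders hC
    set T : (ι → ℝ) → (ι → ℝ) := fun x i => x (e i)
    have hT : MeasurePreserving T P P := by
      refine ⟨by fun_prop, ?_⟩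
      rw [Measure.map_infinitePi_infinitePi_of_inj he]
      simp only [heμ, P]
    have hCA' : P.real (symmDiff C A) ≤ ε := by
      rw [Measure.real]
      exact ENNReal.toReal_le_of_le_ofReal hε.le hCA.le
    have hTC : P (C ∩ T ⁻¹' C) = P C * P (T ⁻¹' C) := by
      have h1 := hind.indepFun_finset S (S.image e) (by
        rw [Finset.disjoint_left]
        intro i hi hi'
        obtain ⟨j, hj, rfl⟩ := Finset.mem_image.1 hi'
        exact heS j hj hi) (fun i => measurable_pi_apply i)
      set r : (↥(S.image e) → ℝ) → S → ℝ :=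
        fun y i => y ⟨e i, Finset.mem_image_of_mem e i.2⟩
      have hr : Measurable r := by fun_prop
      have h2 := h1.measure_inter_preimage_eq_mul B
        (r ⁻¹' B) hB (hr hB)
      exact h2
    have hTC' : P.real (C ∩ T ⁻¹' C) = P.real C ^ 2 := by
      rw [Measure.real, hTC, hT.measure_preimage hCm.nullMeasurableSet, ENNReal.toReal_mul, sq]
      rfl
    have h1 : |P.real C - P.real A| ≤ ε :=
      (abs_measureReal_sub_le_measureReal_symmDiff hCm.nullMeasurableSet
        hA.nullMeasurableSet).trans hCA'
    have h2 : |P.real (C ∩ T ⁻¹' C) - P.real A| ≤ 2 * ε := by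
      have h3 := abs_measureReal_sub_le_measureReal_symmDiff (μ := P)
        (hCm.inter (hT.measurable hCm)).nullMeasurableSet hA.nullMeasurableSet
      refine h3.trans ?_
      have h4 : symmDiff (C ∩ T ⁻¹' C) A ⊆ symmDiff C A ∪ T ⁻¹' (symmDiff C A) := by
        intro x
        have hx : T x ∈ A ↔ x ∈ A := by
          change x ∈ T ⁻¹' A ↔ x ∈ A
          rw [heA]
        simp only [Set.mem_symmDiff, Set.mem_inter_iff, Set.mem_preimage, Set.mem_union, hx]
        tauto
      calc P.real (symmDiff (C ∩ T ⁻¹' C) A) ≤ P.real (symmDiff C A ∪ T ⁻¹' (symmDiff C A)) :=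
            measureReal_mono h4
        _ ≤ P.real (symmDiff C A) + P.real (T ⁻¹' (symmDiff C A)) := measureReal_union_le _ _
        _ = P.real (symmDiff C A) + P.real (symmDiff C A) := by
            congr 1
            simp only [Measure.real]
            rw [hT.measure_preimage (hCm.symmDiff hA).nullMeasurableSet]
        _ ≤ 2 * ε := by linarith
    rw [hTC'] at h2
    have hA1 : P.real A ≤ 1 := measureReal_le_one
    have hC1 : P.real C ≤ 1 := measureReal_le_one
    have hA0 : 0 ≤ P.real A := measureReal_nonneg
    have hC0 : 0 ≤ P.real C := measureReal_nonneg
    rw [abs_le] at h1 h2 ⊢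
    constructor <;> nlinarith
  have h0 : P.real A - P.real A ^ 2 = 0 := by
    rw [← abs_nonpos_iff]
    refine le_of_forall_pos_le_add fun ε hε => ?_
    have := key (ε / 4) (by linarith)
    linarith
  have h1 : P.real A * (1 - P.real A) = 0 := by linarith
  rcases mul_eq_zero.1 h1 with h2 | h2
  · left
    rwa [measureReal_eq_zero_iff] at h2
  · right
    have h3 : (P A).toReal = 1 := by
      change P.real A = 1
      linarith
    rw [← ENNReal.ofReal_toReal (measure_ne_top P A), h3, ENNReal.ofReal_one]

lemma isTranslationErgodic_nu {n : ℕ} (σ : Fin n → ℝ) : IsTranslationErgodic (nu σ) := by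
  constructor
  · intro l
    exact measurePreserving_pi _ _ fun i => measurePreserving_shift_expSeq (σ i) l
  · intro A hA hinv
    have e : nu σ = (Measure.infinitePi fun p : Fin n × ℤ => expMean (σ p.1)).map
        (MeasurableEquiv.curry (Fin n) ℤ ℝ) := by
      rw [nu_eq_infinitePi]
      exact (Measure.infinitePi_map_curry fun (i : Fin n) (_ : ℤ) => expMean (σ i)).symm
    rw [e, Measure.map_apply (MeasurableEquiv.measurable _) hA]
    refine measurableSet_eq_zero_or_one_of_forall_finset (fun p : Fin n × ℤ => expMean (σ p.1))
      (MeasurableEquiv.measurable _ hA) fun S => ?_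
    obtain ⟨N, hN⟩ : ∃ N : ℕ, ∀ p ∈ S, p.2.natAbs < N :=
      ⟨S.sup (fun p => p.2.natAbs) + 1, fun p hp =>
        Nat.lt_succ_of_le (Finset.le_sup (f := fun p : Fin n × ℤ => p.2.natAbs) hp)⟩
    -- All times occurring in `S` lie in `(-N, N)`, so translation by `2 * N` moves `S` off itself.
    refine ⟨fun p => (p.1, p.2 + 2 * N), ?_, ?_, fun _ => rfl, ?_⟩
    · rintro ⟨i, k⟩ ⟨i', k'⟩ h
      simpa using h
    · intro p hp hp'
      have h1 := hN _ hp
      have h2 := hN _ hp'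
      simp only at h2
      omega
    · conv_rhs => rw [← hinv (2 * N)]
      rfl

/-- Equivariant images of translation-ergodic measures are translation-ergodic. -/
lemma IsTranslationErgodic.map {n m : ℕ} {μ : Measure (Config n)} (h : IsTranslationErgodic μ)
    {f : Config n → Config m} (hf : Measurable f)
    (hfT : ∀ l η, f (translate l η) = translate l (f η)) : IsTranslationErgodic (μ.map f) := by
  constructor
  · intro l
    refine ⟨measurable_translate l, ?_⟩
    rw [Measure.map_map (measurable_translate l) hf]
    conv_rhs => rw [← (h.invariant l).map_eq, Measure.map_map hf (measurable_translate l)]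
    congr 1
    funext η
    exact (hfT l η).symm
  · intro A hA hinv
    rw [Measure.map_apply hf hA]
    refine h.trivial_of_invariant _ (hf hA) fun l => ?_
    ext η
    simp only [Set.mem_preimage, hfT]
    conv_rhs => rw [← hinv l]
    rfl

/-! ### Conservation of means -/

/-- Truncation to `[-N, N]`. -/
def clamp (N : ℕ) (a : ℝ) : ℝ := max (-N) (min a N)

lemma clamp_sub_mem {N : ℕ} {a b : ℝ} (h : a ≤ b) :
    0 ≤ clamp N b - clamp N a ∧ clamp N b - clamp N a ≤ b - a := by
  have hN : (0 : ℝ) ≤ N := Nat.cast_nonneg N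
  unfold clamp
  constructor
  · exact sub_nonneg.2 (max_le_max le_rfl (min_le_min h le_rfl))
  · simp only [max_def, min_def]
    split_ifs <;> linarith

lemma abs_clamp_le (N : ℕ) (a : ℝ) : |clamp N a| ≤ N := by
  have hN : (0 : ℝ) ≤ N := Nat.cast_nonneg N
  exact abs_le.2 ⟨le_max_left _ _, max_le (by linarith) (min_le_right _ _)⟩

lemma measurable_clamp (N : ℕ) : Measurable (clamp N) := by unfold clamp; fun_prop

lemma eventually_clamp_eq (a : ℝ) : ∀ᶠ N : ℕ in atTop, clamp N a = a := by
  filter_upwards [eventually_ge_atTop ⌈|a|⌉₊] with N hN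
  have h := (Nat.le_ceil |a|).trans (Nat.cast_le.2 hN)
  rw [abs_le] at h
  rw [clamp, min_eq_left h.2, max_eq_right h.1]

/-- A coboundary that is bounded below by an integrable function is integrable with mean `0`. -/
lemma integrable_and_integral_eq_zero_of_coboundary {Ω : Type*} [MeasurableSpace Ω] {P : Measure Ω}
    [IsProbabilityMeasure P] {T : Ω → Ω} (hT : MeasurePreserving T P P) {J f g : Ω → ℝ}
    (hJ : Measurable J) (hf : ∀ᵐ x ∂P, f x = J (T x) - J x) (hg : Integrable g P)
    (hfg : ∀ᵐ x ∂P, -g x ≤ f x) : Integrable f P ∧ ∫ x, f x ∂P = 0 := by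
  -- `J` need not be integrable, so it is truncated: `φ N` has mean `0`, is at least `-|g|`, and is
  -- dominated by `|f|`. Fatou's lemma for `φ N + |g|` makes `f` integrable, and dominated
  -- convergence then gives its mean.
  set φ : ℕ → Ω → ℝ := fun N x => clamp N (J (T x)) - clamp N (J x)
  have hbd : ∀ N, Integrable (fun x => clamp N (J x)) P := fun N =>
    Integrable.of_bound ((measurable_clamp N).comp hJ).aestronglyMeasurable N
      (ae_of_all _ fun x => abs_clamp_le N (J x))
  have hφi : ∀ N, Integrable (φ N) P := fun N =>
    (hT.integrable_comp_of_integrable (hbd N)).sub (hbd N)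
  have hφ0 : ∀ N, ∫ x, φ N x ∂P = 0 := by
    intro N
    have h1 : ∫ x, clamp N (J (T x)) ∂P = ∫ x, clamp N (J x) ∂P := by
      have := integral_map (μ := P) hT.measurable.aemeasurable
        (f := fun x => clamp N (J x)) ((measurable_clamp N).comp hJ).aestronglyMeasurable
      rw [hT.map_eq] at this
      exact this.symm
    have h2 : Integrable (fun x => clamp N (J (T x))) P := hT.integrable_comp_of_integrable (hbd N)
    simp only [φ]
    rw [integral_sub h2 (hbd N), h1, sub_self]
  have hlim : ∀ᵐ x ∂P, Tendsto (fun N => φ N x) atTop (𝓝 (f x)) := by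
    filter_upwards [hf] with x hx
    rw [hx]
    refine tendsto_const_nhds.congr' ?_
    filter_upwards [eventually_clamp_eq (J (T x)), eventually_clamp_eq (J x)] with N h1 h2
    simp only [φ, h1, h2]
  have hbound : ∀ᵐ x ∂P, ∀ N, -|g x| ≤ φ N x ∧ |φ N x| ≤ |f x| := by
    filter_upwards [hf, hfg] with x hx hx' N
    rw [hx] at hx' ⊢
    have hgx := le_abs_self (g x)
    rcases le_total (J x) (J (T x)) with h | h
    · obtain ⟨h1, h2⟩ := clamp_sub_mem (N := N) h
      have h3 := abs_nonneg (g x)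
      refine ⟨by simp only [φ]; linarith, ?_⟩
      rw [abs_of_nonneg h1, abs_of_nonneg (sub_nonneg.2 h)]
      exact h2
    · obtain ⟨h1, h2⟩ := clamp_sub_mem (N := N) h
      refine ⟨by simp only [φ]; linarith, ?_⟩
      simp only [φ]
      rw [abs_sub_comm, abs_of_nonneg h1, abs_sub_comm, abs_of_nonneg (sub_nonneg.2 h)]
      exact h2
  have hfm : AEStronglyMeasurable f P :=
    ((hJ.comp hT.measurable).sub hJ).aestronglyMeasurable.congr (hf.mono fun x hx => hx.symm)
  have hsum : Integrable (fun x => f x + |g x|) P := by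
    refine ⟨hfm.add hg.abs.aestronglyMeasurable, ?_⟩
    rw [hasFiniteIntegral_iff_ofReal (by
      filter_upwards [hfg] with x hx
      have := le_abs_self (g x)
      simp only [Pi.zero_apply]
      linarith)]
    have h1 : ∀ᵐ x ∂P, ENNReal.ofReal (f x + |g x|) =
        liminf (fun N => ENNReal.ofReal (φ N x + |g x|)) atTop := by
      filter_upwards [hlim] with x hx
      exact ((ENNReal.continuous_ofReal.tendsto _).comp (hx.add_const _)).liminf_eq.symm
    rw [lintegral_congr_ae h1]
    have h2 : ∀ N, ∫⁻ x, ENNReal.ofReal (φ N x + |g x|) ∂P = ENNReal.ofReal (∫ x, |g x| ∂P) := by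
      intro N
      have h3 : Integrable (fun x => φ N x + |g x|) P := (hφi N).add hg.abs
      rw [← ofReal_integral_eq_lintegral_ofReal h3 (by
        filter_upwards [hbound] with x hx
        have := (hx N).1
        simp only [Pi.zero_apply]
        linarith), integral_add (hφi N) hg.abs, hφ0, zero_add]
    refine lt_of_le_of_lt (lintegral_liminf_le' fun N =>
      ((hφi N).add hg.abs).aestronglyMeasurable.aemeasurable.ennreal_ofReal) ?_
    simp_rw [h2]
    simp
  have hfi : Integrable f P := by
    refine (hsum.sub hg.abs).congr (ae_of_all _ fun x => ?_)
    simp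
  refine ⟨hfi, ?_⟩
  have h := tendsto_integral_of_dominated_convergence (F := φ) (fun x => |f x|)
    (fun N => (hφi N).aestronglyMeasurable) hfi.abs
    (fun N => hbound.mono fun x hx => (hx N).2) hlim
  simp_rw [hφ0] at h
  exact tendsto_nhds_unique h tendsto_const_nhds

lemma measurable_sojourn {α : Type*} [MeasurableSpace α] {f g : α → BiSeq}
    (hf : Measurable f) (hg : Measurable g) (l : ℤ) :
    Measurable (fun a => sojourn (f a) (g a) l) := by
  unfold sojourn heightOut height
  exact (Measurable.iSup fun k => by fun_prop).sub (by fun_prop)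

/-- In a stationary queue, departures have the same mean as arrivals. -/
lemma integrable_departure {Ω : Type*} [MeasurableSpace Ω] {P : Measure Ω}
    [IsProbabilityMeasure P] {T : Ω → Ω} (hT : MeasurePreserving T P P) {I ω : Ω → BiSeq}
    (hI : Measurable I) (hω : Measurable ω) (hIT : ∀ x, I (T x) = shift 1 (I x))
    (hωT : ∀ x, ω (T x) = shift 1 (ω x)) (hf : ∀ᵐ x ∂P, FiniteQueue (I x) (ω x))
    (h0 : ∀ᵐ x ∂P, ∀ k, 0 ≤ ω x k) {l : ℤ} (hint : Integrable (fun x => I x l) P) :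
    Integrable (fun x => departure (I x) (ω x) l) P ∧
      ∫ x, departure (I x) (ω x) l ∂P = ∫ x, I x l ∂P := by
  -- `D - I` at `l` is the increment of the sojourn time from `l - 1` to `l`, and is at least `-I`
  -- because departures are nonnegative.
  have h := integrable_and_integral_eq_zero_of_coboundary hT
    (J := fun x => sojourn (I x) (ω x) (l - 1)) (f := fun x => departure (I x) (ω x) l - I x l)
    (g := fun x => I x l) (measurable_sojourn hI hω _) (by
      filter_upwards [hf] with x hx
      rw [hIT, hωT, hx.sojourn_shift, departure_eq_add_sojourn', sub_add_cancel]
      ring) hint (by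
      filter_upwards [hf, h0] with x hx hx0
      have := (hx0 l).trans (hx.le_departure l)
      linarith)
  have h1 : Integrable (fun x => departure (I x) (ω x) l) P := by
    refine (h.1.add hint).congr (ae_of_all _ fun x => ?_)
    simp
  refine ⟨h1, ?_⟩
  have h2 := h.2
  rw [integral_sub h1 hint] at h2
  linarith

/-! ### The measures `μ^ρ` -/

lemma sortedValues_strictMono {n : ℕ} (ρ : Fin n → ℝ) : StrictMono (sortedValues ρ) :=
  ((values ρ).orderEmbOfFin rfl).strictMono

lemma sortedValues_valueIndex {n : ℕ} (ρ : Fin n → ℝ) (i : Fin n) :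
    sortedValues ρ (valueIndex ρ i) = ρ i := by
  unfold sortedValues valueIndex
  rw [← Finset.coe_orderIsoOfFin_apply]
  simp

lemma lt_sortedValues {n : ℕ} {ρ : Fin n → ℝ} {c : ℝ} (h : ∀ i, c < ρ i)
    (j : Fin (values ρ).card) : c < sortedValues ρ j := by
  have h1 : sortedValues ρ j ∈ values ρ := Finset.orderEmbOfFin_mem _ _ _
  obtain ⟨i, -, hi⟩ := Finset.mem_image.1 h1
  rw [← hi]
  exact h i

/-- The multiqueue map followed by the repetition of lines with equal densities. -/
def repeatedMultiqueue {n : ℕ} (ρ : Fin n → ℝ) (I : Config (values ρ).card) : Config n :=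
  fun i => multiqueue I (valueIndex ρ i)

lemma measurable_repeatedMultiqueue {n : ℕ} (ρ : Fin n → ℝ) :
    Measurable (repeatedMultiqueue ρ) :=
  measurable_pi_lambda _ fun _ => (measurable_pi_apply _).comp (measurable_multiqueue _)

lemma mu_eq_map {n : ℕ} (ρ : Fin n → ℝ) :
    mu ρ = (nu (sortedValues ρ)).map (repeatedMultiqueue ρ) := by
  rw [mu, muStrict, Measure.map_map (by fun_prop) (measurable_multiqueue _)]
  rfl

lemma measurePreserving_repeatedMultiqueue {n : ℕ} (ρ : Fin n → ℝ) :
    MeasurePreserving (repeatedMultiqueue ρ) (nu (sortedValues ρ)) (mu ρ) :=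
  ⟨measurable_repeatedMultiqueue ρ, (mu_eq_map ρ).symm⟩

instance {n : ℕ} (ρ : Fin n → ℝ) : IsProbabilityMeasure (mu ρ) := by
  rw [mu_eq_map]
  exact Measure.isProbabilityMeasure_map (measurable_repeatedMultiqueue ρ).aemeasurable

lemma mu_ae_hasAverage {n : ℕ} {ρ : Fin n → ℝ} (hρ : ∀ i, 0 < ρ i) :
    ∀ᵐ η ∂(mu ρ), ∀ i, HasAverage (η i) (ρ i) := by
  have hms : MeasurableSet {η : Config n | ∀ i, HasAverage (η i) (ρ i)} := by
    have e : {η : Config n | ∀ i, HasAverage (η i) (ρ i)} = ⋂ i, ((⋂ k, {η | 0 ≤ η i k}) ∩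
        {η | Tendsto (fun m => leftAverage (η i) m) atBot (𝓝 (ρ i))}) := by
      ext η
      simp only [Set.mem_ofPred_eq, Set.mem_iInter, Set.mem_inter_iff]
      exact forall_congr' fun i => ⟨fun h => ⟨h.nonneg, h.tendsto⟩, fun h => ⟨h.1, h.2⟩⟩
    rw [e]
    refine MeasurableSet.iInter fun i => (MeasurableSet.iInter fun k =>
      measurableSet_le (by fun_prop) (by fun_prop)).inter ?_
    refine measurableSet_tendsto _ fun m => ?_
    unfold leftAverage
    fun_prop
  rw [mu_eq_map, ae_map_iff (measurable_repeatedMultiqueue ρ).aemeasurable hms]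
  filter_upwards [nu_ae_hasAverage (lt_sortedValues hρ)] with I hI i
  rw [← sortedValues_valueIndex ρ i]
  exact hasAverage_multiqueue (sortedValues_strictMono ρ) hI _

lemma mu_ae_mem_stateSpace {n : ℕ} {ρ : Fin n → ℝ} (hρ : ∀ i, 1 < ρ i) :
    ∀ᵐ η ∂(mu ρ), η ∈ stateSpace n := by
  filter_upwards [mu_ae_hasAverage fun i => one_pos.trans (hρ i)] with η hη
  exact ⟨fun i k => (hη i).nonneg k, fun i => ⟨ρ i, hρ i, (hη i).tendsto⟩⟩

lemma isTranslationErgodic_mu {n : ℕ} (ρ : Fin n → ℝ) : IsTranslationErgodic (mu ρ) := by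
  rw [mu_eq_map]
  refine (isTranslationErgodic_nu _).map (measurable_repeatedMultiqueue ρ) fun l I => ?_
  funext i
  simp only [repeatedMultiqueue, multiqueue_translate]
  rfl

lemma integrable_multiqueue {n : ℕ} {σ : Fin n → ℝ} (hσ : StrictMono σ) (hσ0 : ∀ i, 0 < σ i)
    (i : Fin n) (l : ℤ) : Integrable (fun I => multiqueue I i l) (nu σ) ∧
      ∫ I, multiqueue I i l ∂(nu σ) = σ i := by
  have hlt : ∀ j, i.val - j < n := fun j => lt_of_le_of_lt (Nat.sub_le _ _) i.isLt
  have key : ∀ k ≤ i.val,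
      Integrable (fun I : Config n => tandem (fun j => I ⟨i.val - j, hlt j⟩) k l) (nu σ) ∧
        ∫ I : Config n, tandem (fun j => I ⟨i.val - j, hlt j⟩) k l ∂(nu σ) = σ i := by
    intro k hk
    induction k with
    | zero =>
      have h1 : MeasurePreserving (Function.eval i : Config n → BiSeq) (nu σ) (expSeq (σ i)) :=
        measurePreserving_eval (fun i => expSeq (σ i)) i
      have h2 := integrable_expSeq (hσ0 i) l
      refine ⟨h1.integrable_comp_of_integrable h2, ?_⟩
      have h3 := integral_map (μ := nu σ) h1.measurable.aemeasurable
        (f := fun x : BiSeq => x l) (measurable_pi_apply l).aestronglyMeasurable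
      rw [h1.map_eq, integral_expSeq (hσ0 i)] at h3
      exact h3.symm
    | succ k ih =>
      obtain ⟨ih1, ih2⟩ := ih (by omega)
      have h := integrable_departure ((isTranslationErgodic_nu σ).invariant 1)
        (I := fun I : Config n => tandem (fun j => I ⟨i.val - j, hlt j⟩) k)
        (ω := fun I => I ⟨i.val - (k + 1), hlt (k + 1)⟩)
        (measurable_tandem _ (fun j => measurable_pi_apply _) k) (measurable_pi_apply _)
        (fun I => tandem_shift 1 _ k) (fun I => rfl) (by
          filter_upwards [nu_ae_hasAverage hσ0] with I hI
          have ht : HasAverage (tandem (fun j => I ⟨i.val - j, hlt j⟩) k) (σ ⟨i.val - 0, hlt 0⟩) :=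
            HasAverage.tandem (ζ := fun j => I ⟨i.val - j, hlt j⟩)
              (τ := fun j => σ ⟨i.val - j, hlt j⟩) k (fun j _ => hI _)
              (fun j hj hj0 => hσ (by simp only [Fin.lt_def]; omega))
          exact (ht.stable (hI _) (hσ (by simp only [Fin.lt_def]; omega))).finiteQueue) (by
          filter_upwards [nu_ae_hasAverage hσ0] with I hI
          exact (hI _).nonneg) ih1
      exact ⟨h.1, h.2.trans ih2⟩
  exact key i.val le_rfl

lemma hasMeanVector_mu {n : ℕ} {ρ : Fin n → ℝ} (hρ : ∀ i, 0 < ρ i) : HasMeanVector (mu ρ) ρ := by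
  intro i k
  have h := integrable_multiqueue (sortedValues_strictMono ρ) (lt_sortedValues hρ)
    (valueIndex ρ i) k
  have hm := measurable_repeatedMultiqueue ρ
  have he : Measurable (fun η : Config n => η i k) :=
    (measurable_pi_apply k).comp (measurable_pi_apply i)
  have hs : AEStronglyMeasurable (fun η : Config n => η i k) (mu ρ) := he.aestronglyMeasurable
  rw [mu_eq_map] at hs ⊢
  rw [integrable_map_measure hs hm.aemeasurable, integral_map hm.aemeasurable hs]
  exact ⟨h.1, h.2.trans (sortedValues_valueIndex ρ i)⟩

/-! ### Invariance -/

lemma bind_coupledKernel {n : ℕ} (μ : Measure (Config n)) [SFinite μ] :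
    μ.bind (coupledKernel n) = (μ.prod (expSeq 1)).map (fun p => coupledStep p.1 p.2) := by
  have hm := measurable_coupledStep n
  ext s hs
  rw [Measure.bind_apply hs (coupledKernel n).aemeasurable, Measure.map_apply hm hs,
    Measure.prod_apply (hm hs)]
  refine lintegral_congr fun η => ?_
  have hη : Measurable (coupledStep η) :=
    measurable_pi_lambda _ fun i => measurable_departure measurable_const measurable_id
  rw [coupledKernel_apply, Measure.map_apply hη hs]
  rfl

lemma IsInvariantForCoupled.measurePreserving {n : ℕ} {μ : Measure (Config n)} [SFinite μ]
    (h : IsInvariantForCoupled μ) :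
    MeasurePreserving (fun p : Config n × BiSeq => coupledStep p.1 p.2) (μ.prod (expSeq 1)) μ :=
  ⟨measurable_coupledStep n, (bind_coupledKernel μ).symm.trans h.invariant⟩

lemma isInvariantForCoupled_mu {n : ℕ} {ρ : Fin n → ℝ} (hρ : ∀ i, 1 < ρ i) :
    IsInvariantForCoupled (mu ρ) := by
  have hρ0 : ∀ i, 0 < ρ i := fun i => one_pos.trans (hρ i)
  constructor
  · filter_upwards [ae_prod_of_ae (mu_ae_hasAverage hρ0) (expSeq_ae_hasAverage one_pos)]
      with p hp i
    exact (hp.1 i).stable hp.2 (hρ i)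
  · have hΦ := measurePreserving_repeatedMultiqueue ρ
    have h1 := hΦ.prod (MeasurePreserving.id (expSeq 1))
    have h2 := measurePreserving_passDeparture one_pos (lt_sortedValues hρ)
    rw [Kernel.Invariant, bind_coupledKernel, ← h1.map_eq,
      Measure.map_map (measurable_coupledStep n) h1.measurable, ← (hΦ.comp h2).map_eq]
    refine Measure.map_congr ?_
    filter_upwards [ae_prod_of_ae (nu_ae_hasAverage (lt_sortedValues hρ0))
      (expSeq_ae_hasAverage one_pos)] with p hp
    have h3 := coupledStep_multiqueue (sortedValues_strictMono ρ) hp.1 hp.2 (lt_sortedValues hρ)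
    funext i
    exact congrFun h3 (valueIndex ρ i)

/-! ### Strict contraction -/

/-- If `I ≤ Z` with strict inequality somewhere during a busy period of the queue `Z`, then the
first departure of `Z` after this busy period is delayed strictly less in `Z`. -/
lemma departure_lt_of_busy {I Z ω : BiSeq} (hI : FiniteQueue I ω) (hZ : FiniteQueue Z ω)
    (hIZ : ∀ k, I k ≤ Z k) {p M : ℤ} (hp : p < M) (hlt : I p < Z p)
    (hbusy : ∀ m, p ≤ m → m < M → Z m ≤ sojourn Z ω (m - 1)) (hM : sojourn Z ω (M - 1) < Z M) :
    departure I ω M < departure Z ω M := by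
  have key : ∀ m, p ≤ m → m < M → sojourn Z ω m < sojourn I ω m := by
    intro m hm
    have hle := sojourn_anti hI hIZ
    -- Arrivals in `I` come no later, so its server is busy as well. The gap between the sojourn
    -- times then grows by `Z m - I m`, strictly at `p`, and never shrinks before `M`.
    have hrec : ∀ m, p ≤ m → m < M →
        sojourn I ω m - sojourn Z ω m = sojourn I ω (m - 1) - sojourn Z ω (m - 1) + (Z m - I m) := by
      intro m h1 h2
      have h3 := hbusy m h1 h2
      have h4 := hI.sojourn_of_busy (l := m - 1)
      have h5 := hZ.sojourn_of_busy (l := m - 1)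
      simp only [sub_add_cancel] at h4 h5
      rw [h4 ((hIZ m).trans (h3.trans (hle _))), h5 h3]
      ring
    induction m, hm using Int.leInduction with
    | base =>
      intro h
      have := hrec p le_rfl h
      have := hle (p - 1)
      linarith
    | succ m hm ih =>
      intro h
      have h1 := hrec (m + 1) (by omega) h
      have h2 := ih (by omega)
      have h3 := hIZ (m + 1)
      rw [add_sub_cancel_right] at h1
      linarith
  have h1 := key (M - 1) (by omega) (by omega)
  have h2 := hI.departure_succ (M - 1)
  have h3 := hZ.departure_succ (M - 1)
  rw [sub_add_cancel] at h2 h3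
  rw [h2, h3, max_eq_left (by linarith : 0 ≤ Z M - sojourn Z ω (M - 1))]
  have h4 : max (I M - sojourn I ω (M - 1)) 0 < Z M - sojourn Z ω (M - 1) :=
    max_lt (by linarith [hIZ M]) (by linarith)
  linarith

/-- A long service makes the following customers wait. -/
lemma lt_of_idle_of_sum_lt {Z ω : BiSeq} (hZ : FiniteQueue Z ω) (hZ0 : ∀ k, 0 ≤ Z k)
    (hω : ∀ k, 0 ≤ ω k) {p q M : ℤ} (hpM : p ≤ M)
    (hbig : ∑ k ∈ Finset.Icc p q, Z k < ω (p - 1))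
    (hbusy : ∀ m, p ≤ m → m < M → Z m ≤ sojourn Z ω (m - 1)) (hM : sojourn Z ω (M - 1) < Z M) :
    q < M := by
  by_contra! hMq
  have key : ∀ m, p ≤ m → m ≤ M →
      ω (p - 1) - ∑ k ∈ Finset.Icc p (m - 1), Z k ≤ sojourn Z ω (m - 1) := by
    intro m hm
    induction m, hm using Int.leInduction with
    | base => intro _; simpa using hZ.le_sojourn (p - 1)
    | succ m hm ih =>
      intro h
      have h1 := ih (by omega)
      have h2 := hbusy m hm (by omega)
      have h3 := hZ.sojourn_of_busy (l := m - 1)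
      have h4 := sum_Icc_succ_right Z (show p ≤ m - 1 + 1 by omega)
      rw [sub_add_cancel] at h3 h4
      rw [add_sub_cancel_right, h3 h2, h4]
      linarith [hω m]
  have h1 := key M hpM le_rfl
  have h2 := sum_Icc_succ_right Z (show p ≤ M - 1 + 1 by omega)
  have h3 := sum_Icc_append Z (show p ≤ M + 1 by omega) hMq
  have h4 : 0 ≤ ∑ k ∈ Finset.Icc (M + 1) q, Z k := Finset.sum_nonneg fun k _ => hZ0 k
  rw [sub_add_cancel] at h2
  linarith

lemma exists_first_ge {p : ℤ} {Q : ℤ → Prop} (h : ∃ M, p ≤ M ∧ Q M) :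
    ∃ M, p ≤ M ∧ Q M ∧ ∀ m, p ≤ m → m < M → ¬ Q m := by
  obtain ⟨M, hM, hQ⟩ := h
  obtain ⟨N, ⟨h1, h2⟩, h3⟩ := Int.exists_least_of_bdd (P := fun m => p ≤ m ∧ Q m)
    ⟨p, fun z hz => hz.1⟩ ⟨M, hM, hQ⟩
  exact ⟨N, h1, h2, fun m hm hmN hQm => absurd (h3 m ⟨hm, hQm⟩) (by omega)⟩

/-- Coordinatewise maximum of two sequences. -/
def maxSeq (x y : BiSeq) : BiSeq := fun k => max (x k) (y k)

lemma le_maxSeq_left (x y : BiSeq) (k : ℤ) : x k ≤ maxSeq x y k := le_max_left _ _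

lemma le_maxSeq_right (x y : BiSeq) (k : ℤ) : y k ≤ maxSeq x y k := le_max_right _ _

/-- If two sequences cross and a long service precedes the crossings, then the departures of their
maximum are somewhere larger than the maximum of their departures. -/
lemma exists_max_departure_lt {x y ω : BiSeq} (hx : FiniteQueue x ω) (hy : FiniteQueue y ω)
    (hz : FiniteQueue (maxSeq x y) ω) (hx0 : ∀ k, 0 ≤ x k) (hω : ∀ k, 0 ≤ ω k)
    {p q : ℤ} (hp : x p < y p) (hq : y q < x q)
    (hbig : ∑ k ∈ Finset.Icc (min p q) (max p q), maxSeq x y k < ω (min p q - 1))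
    (hidle : ∃ M, min p q ≤ M ∧ sojourn (maxSeq x y) ω (M - 1) < maxSeq x y M) :
    ∃ M, max (departure x ω M) (departure y ω M) < departure (maxSeq x y) ω M := by
  obtain ⟨M, hM1, hM2, hM3⟩ := exists_first_ge hidle
  simp only [not_lt] at hM3
  -- The long service keeps the server of the maximum busy beyond both crossings, so the single idle
  -- time `M` serves for the comparison with `x` and with `y`.
  have hlt := lt_of_idle_of_sum_lt hz (fun k => (hx0 k).trans (le_maxSeq_left x y k)) hω hM1 hbig
    hM3 hM2
  have h1 := min_le_left p q
  have h2 := min_le_right p q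
  have h3 := le_max_left p q
  have h4 := le_max_right p q
  exact ⟨M, max_lt
    (departure_lt_of_busy hx hz (le_maxSeq_left x y) (p := p) (by omega)
      (hp.trans_le (le_maxSeq_right x y p)) (fun m hm => hM3 m (by omega)) hM2)
    (departure_lt_of_busy hy hz (le_maxSeq_right x y) (p := q) (by omega)
      (hq.trans_le (le_maxSeq_left x y q)) (fun m hm => hM3 m (by omega)) hM2)⟩

lemma shift_zero (x : BiSeq) : shift 0 x = x := by funext k; simp [shift]

lemma shift_shift (a b : ℤ) (x : BiSeq) : shift a (shift b x) = shift (a + b) x := by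
  funext k; simp only [shift]; congr 1; ring

/-! ### Contraction for jointly stationary pairs. -/

section Stationary

variable {Ω : Type*} [MeasurableSpace Ω] {P : Measure Ω} {τ : ℤ → Ω → Ω}

/-- The idle times of a stationary stable queue are unbounded in the future. -/
lemma ae_exists_idle_ge [IsProbabilityMeasure P]
    (hτ : ∀ l, MeasurePreserving (τ l) P P) {Z ω : Ω → BiSeq}
    (hZ : Measurable Z) (hω : Measurable ω) (hZτ : ∀ l x, Z (τ l x) = shift l (Z x))
    (hωτ : ∀ l x, ω (τ l x) = shift l (ω x)) (hst : ∀ᵐ x ∂P, Stable (Z x) (ω x)) :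
    ∀ᵐ x ∂P, ∀ p, ∃ M, p ≤ M ∧ sojourn (Z x) (ω x) (M - 1) < Z x M := by
  set E : Set Ω := {x | sojourn (Z x) (ω x) (-1) < Z x 0}
  have hE : MeasurableSet E :=
    measurableSet_lt (measurable_sojourn hZ hω _) ((measurable_pi_apply 0).comp hZ)
  -- Poincaré recurrence carries an idle time in the past, supplied by stability, to arbitrarily
  -- late idle times.
  have h1 := (hτ 1).conservative.ae_mem_imp_frequently_image_mem hE.nullMeasurableSet
  have h2 : ∀ᵐ x ∂P, ∀ k : ℤ, τ k x ∈ E → ∃ᶠ n in atTop, (τ 1)^[n] (τ k x) ∈ E :=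
    ae_all_iff.2 fun k => (hτ k).quasiMeasurePreserving.ae h1
  have hit : ∀ (n : ℕ) (x : Ω), Z ((τ 1)^[n] x) = shift n (Z x) ∧
      ω ((τ 1)^[n] x) = shift n (ω x) := by
    intro n x
    induction n with
    | zero => simp [shift_zero]
    | succ n ih =>
      rw [Function.iterate_succ_apply', hZτ, hωτ, ih.1, ih.2, shift_shift, shift_shift]
      push_cast
      rw [add_comm]
      exact ⟨rfl, rfl⟩
  filter_upwards [h2, hst] with x hx hs p
  have hf := hs.finiteQueue
  have hE' : ∀ (k : ℤ) (n : ℕ), (τ 1)^[n] (τ k x) ∈ E ↔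
      sojourn (Z x) (ω x) (n + k - 1) < Z x (n + k) := by
    intro k n
    change sojourn _ _ (-1) < Z ((τ 1)^[n] (τ k x)) 0 ↔ _
    rw [(hit n _).1, (hit n _).2, hZτ, hωτ, shift_shift, shift_shift, hf.sojourn_shift]
    simp only [shift]
    rw [show -1 + ((n : ℤ) + k) = n + k - 1 by ring, zero_add]
  obtain ⟨k, -, hk⟩ := hs.exists_idle 0
  have h3 := hx k (by
    have := hE' k 0
    simp only [Function.iterate_zero, id, CharP.cast_eq_zero, zero_add] at this
    exact this.2 hk)
  obtain ⟨n, hn, hn'⟩ := (h3.and_eventually (eventually_ge_atTop (p - k).toNat)).exists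
  exact ⟨n + k, by omega, (hE' k n).1 hn⟩

/-- Two jointly stationary sequences that never cross and have the same mean on every invariant
event are equal, up to exchanging them. -/
lemma ae_forall_le_of_not_cross (hτ : ∀ l, MeasurePreserving (τ l) P P) {X Y : Ω → BiSeq}
    (hX : Measurable X) (hY : Measurable Y) (hXτ : ∀ l x, X (τ l x) = shift l (X x))
    (hYτ : ∀ l x, Y (τ l x) = shift l (Y x)) (hXi : Integrable (fun x => X x 0) P)
    (hYi : Integrable (fun x => Y x 0) P)
    (hinv : ∀ A, MeasurableSet A → (∀ l, τ l ⁻¹' A = A) →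
      ∫ x in A, X x 0 ∂P = ∫ x in A, Y x 0 ∂P)
    (hcross : ∀ p q, ∀ᵐ x ∂P, ¬ (X x p < Y x p ∧ Y x q < X x q)) :
    ∀ᵐ x ∂P, ∀ p, Y x p ≤ X x p := by
  set A : Set Ω := {x | ∃ p, X x p < Y x p}
  have hA : MeasurableSet A := by
    have e : A = ⋃ p, {x | X x p < Y x p} := by ext x; simp [A]
    rw [e]
    exact MeasurableSet.iUnion fun p => measurableSet_lt (by fun_prop) (by fun_prop)
  have hAτ : ∀ l x, τ l x ∈ A ↔ x ∈ A := by
    intro l x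
    change (∃ p, X (τ l x) p < Y (τ l x) p) ↔ ∃ p, X x p < Y x p
    simp only [hXτ, hYτ, shift]
    exact ⟨fun ⟨p, hp⟩ => ⟨p + l, hp⟩, fun ⟨p, hp⟩ => ⟨p - l, by simpa using hp⟩⟩
  have hle : ∀ᵐ x ∂P, x ∈ A → ∀ q, X x q ≤ Y x q := by
    have : ∀ᵐ x ∂P, ∀ p q, ¬ (X x p < Y x p ∧ Y x q < X x q) :=
      ae_all_iff.2 fun p => ae_all_iff.2 fun q => hcross p q
    filter_upwards [this] with x hx ⟨p, hp⟩ q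
    exact not_lt.1 fun h => hx p q ⟨hp, h⟩
  -- On the invariant event `A` the absence of crossings orders the sequences, and equal means force
  -- equality. By stationarity this holds at every site, contradicting the definition of `A`, which
  -- is therefore null.
  have h0 : ∀ᵐ x ∂P, x ∈ A → X x 0 = Y x 0 := by
    have h1 := hinv A hA fun l => Set.ext fun x => hAτ l x
    have h2 : ∫ x in A, (Y x 0 - X x 0) ∂P = 0 := by
      rw [integral_sub hYi.integrableOn hXi.integrableOn, h1, sub_self]
    rw [integral_eq_zero_iff_of_nonneg_ae] at h2
    · rw [← ae_restrict_iff' hA]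
      filter_upwards [h2] with x hx
      simp only [Pi.zero_apply] at hx
      linarith
    · rw [EventuallyLE, ae_restrict_iff' hA]
      filter_upwards [hle] with x hx hxA
      simpa using hx hxA 0
    · exact hYi.integrableOn.sub hXi.integrableOn
  have h1 : ∀ᵐ x ∂P, ∀ l, τ l x ∈ A → X (τ l x) 0 = Y (τ l x) 0 :=
    ae_all_iff.2 fun l => (hτ l).quasiMeasurePreserving.ae h0
  filter_upwards [h1] with x hx p
  by_contra! hp
  have h2 := hx p ((hAτ p x).2 ⟨p, hp⟩)
  simp only [hXτ, hYτ, shift, zero_add] at h2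
  exact hp.ne h2

lemma measurable_maxSeq {X Y : Ω → BiSeq} (hX : Measurable X) (hY : Measurable Y) :
    Measurable (fun x => maxSeq (X x) (Y x)) :=
  measurable_pi_lambda _ fun k =>
    ((measurable_pi_apply k).comp hX).max ((measurable_pi_apply k).comp hY)

/-- Feeding two jointly stationary sequences into queues with the same services does not increase
their distance, and if it does not decrease it then the departures of the maximum are the maximum
of the departures. -/
lemma integral_abs_departure_sub_le [IsProbabilityMeasure P]
    (hτ : ∀ l, MeasurePreserving (τ l) P P) {X Y ω : Ω → BiSeq}
    (hX : Measurable X) (hY : Measurable Y) (hω : Measurable ω)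
    (hXτ : ∀ l x, X (τ l x) = shift l (X x)) (hYτ : ∀ l x, Y (τ l x) = shift l (Y x))
    (hωτ : ∀ l x, ω (τ l x) = shift l (ω x)) (hω0 : ∀ᵐ x ∂P, ∀ k, 0 ≤ ω x k)
    (hXst : ∀ᵐ x ∂P, Stable (X x) (ω x)) (hYst : ∀ᵐ x ∂P, Stable (Y x) (ω x))
    (hXi : Integrable (fun x => X x 0) P) (hYi : Integrable (fun x => Y x 0) P) :
    ∫ x, |departure (X x) (ω x) 0 - departure (Y x) (ω x) 0| ∂P ≤ ∫ x, |X x 0 - Y x 0| ∂P ∧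
      (∫ x, |X x 0 - Y x 0| ∂P ≤ ∫ x, |departure (X x) (ω x) 0 - departure (Y x) (ω x) 0| ∂P →
        ∀ᵐ x ∂P, ∀ l, departure (maxSeq (X x) (Y x)) (ω x) l =
          max (departure (X x) (ω x) l) (departure (Y x) (ω x) l)) := by
  have hZ := measurable_maxSeq hX hY
  have hZst : ∀ᵐ x ∂P, Stable (maxSeq (X x) (Y x)) (ω x) :=
    hXst.mono fun x hx => hx.mono (le_maxSeq_left _ _)
  have hZi : Integrable (fun x => maxSeq (X x) (Y x) 0) P := hXi.sup hYi
  have hZτ : ∀ l x, maxSeq (X (τ l x)) (Y (τ l x)) = shift l (maxSeq (X x) (Y x)) := by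
    intro l x
    rw [hXτ, hYτ]; rfl
  obtain ⟨hU, hU'⟩ := integrable_departure (hτ 1) hX hω (hXτ 1) (hωτ 1)
    (hXst.mono fun x h => h.finiteQueue) hω0 hXi
  obtain ⟨hV, hV'⟩ := integrable_departure (hτ 1) hY hω (hYτ 1) (hωτ 1)
    (hYst.mono fun x h => h.finiteQueue) hω0 hYi
  obtain ⟨hW, hW'⟩ := integrable_departure (hτ 1) hZ hω (hZτ 1) (hωτ 1)
    (hZst.mono fun x h => h.finiteQueue) hω0 hZi
  have hmono : ∀ᵐ x ∂P, ∀ l, max (departure (X x) (ω x) l) (departure (Y x) (ω x) l) ≤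
      departure (maxSeq (X x) (Y x)) (ω x) l := by
    filter_upwards [hXst, hYst, hZst] with x h1 h2 h3 l
    exact max_le (departure_mono h1.finiteQueue h3.finiteQueue (le_maxSeq_left _ _) l)
      (departure_mono h2.finiteQueue h3.finiteQueue (le_maxSeq_right _ _) l)
  -- Expressed through maxima, the loss of distance is twice the mean of the departure of the
  -- maximum minus the maximum of the departures, as all other terms are conserved.
  have habs : ∀ a b : ℝ, |a - b| = 2 * max a b - (a + b) := by
    intro a b
    rcases le_total a b with h | h
    · rw [abs_sub_comm, abs_of_nonneg (by linarith), max_eq_right h]; ring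
    · rw [abs_of_nonneg (by linarith), max_eq_left h]; ring
  set W : Ω → ℝ := fun x => departure (maxSeq (X x) (Y x)) (ω x) 0
  set U : Ω → ℝ := fun x => departure (X x) (ω x) 0
  set V : Ω → ℝ := fun x => departure (Y x) (ω x) 0
  have hUV : Integrable (fun x => |U x - V x|) P := (hU.sub hV).abs
  have hWUV : Integrable (fun x => 2 * W x - (U x + V x)) P := (hW.const_mul 2).sub (hU.add hV)
  have hmean : ∫ x, (2 * W x - (U x + V x)) ∂P = ∫ x, |X x 0 - Y x 0| ∂P := by
    have hUV' : Integrable (fun x => U x + V x) P := hU.add hV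
    have hXY' : Integrable (fun x => X x 0 + Y x 0) P := hXi.add hYi
    have hZ' : Integrable (fun x => 2 * max (X x 0) (Y x 0)) P := hZi.const_mul 2
    simp_rw [habs]
    rw [integral_sub (hW.const_mul 2) hUV', integral_sub hZ' hXY',
      integral_const_mul, integral_const_mul, integral_add hU hV, integral_add hXi hYi, hU', hV',
      hW']
    rfl
  have hpt : ∀ᵐ x ∂P, |U x - V x| ≤ 2 * W x - (U x + V x) := by
    filter_upwards [hmono] with x hx
    rw [habs]
    linarith [hx 0]
  refine ⟨(integral_mono_ae hUV hWUV hpt).trans hmean.le, fun hge => ?_⟩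
  have h1 : ∫ x, (2 * W x - (U x + V x) - |U x - V x|) ∂P = 0 := by
    rw [integral_sub hWUV hUV, hmean]
    exact le_antisymm (sub_nonpos.2 hge)
      (sub_nonneg.2 ((integral_mono_ae hUV hWUV hpt).trans hmean.le))
  have hdiff : Integrable (fun x => 2 * W x - (U x + V x) - |U x - V x|) P := hWUV.sub hUV
  rw [integral_eq_zero_iff_of_nonneg_ae (hpt.mono fun x hx => by
    simp only [Pi.zero_apply]; linarith) hdiff] at h1
  have h2 : ∀ᵐ x ∂P, W x = max (U x) (V x) := by
    filter_upwards [h1] with x hx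
    rw [habs] at hx
    simp only [Pi.zero_apply] at hx
    linarith
  have h3 : ∀ᵐ x ∂P, ∀ l, W (τ l x) = max (U (τ l x)) (V (τ l x)) :=
    ae_all_iff.2 fun l => (hτ l).quasiMeasurePreserving.ae h2
  filter_upwards [h3] with x hx l
  have hW : W (τ l x) = departure (maxSeq (X x) (Y x)) (ω x) l := by
    simp only [W]
    rw [hZτ, hωτ, departure_shift]
    simp [shift]
  have h := hx l
  rw [hW] at h
  simp only [U, V, hXτ, hYτ, hωτ, departure_shift] at h
  simpa [shift] using h

/-- Strictness in `integral_abs_departure_sub_le`. -/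
lemma ae_eq_of_integral_abs_le [IsProbabilityMeasure P]
    (hτ : ∀ l, MeasurePreserving (τ l) P P) {X Y ω : Ω → BiSeq}
    (hX : Measurable X) (hY : Measurable Y) (hω : Measurable ω)
    (hXτ : ∀ l x, X (τ l x) = shift l (X x)) (hYτ : ∀ l x, Y (τ l x) = shift l (Y x))
    (hωτ : ∀ l x, ω (τ l x) = shift l (ω x)) (hω0 : ∀ᵐ x ∂P, ∀ k, 0 ≤ ω x k)
    (hX0 : ∀ᵐ x ∂P, ∀ k, 0 ≤ X x k)
    (hXst : ∀ᵐ x ∂P, Stable (X x) (ω x)) (hYst : ∀ᵐ x ∂P, Stable (Y x) (ω x))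
    (hXi : Integrable (fun x => X x 0) P) (hYi : Integrable (fun x => Y x 0) P)
    (hinv : ∀ A, MeasurableSet A → (∀ l, τ l ⁻¹' A = A) →
      ∫ x in A, X x 0 ∂P = ∫ x in A, Y x 0 ∂P)
    (hbig : ∀ B : Set (BiSeq × BiSeq), MeasurableSet B → ∀ (k : ℤ) (N : ℕ),
      P {x | (X x, Y x) ∈ B} ≠ 0 → P {x | (X x, Y x) ∈ B ∧ N < ω x k} ≠ 0)
    (hge : ∫ x, |X x 0 - Y x 0| ∂P ≤
      ∫ x, |departure (X x) (ω x) 0 - departure (Y x) (ω x) 0| ∂P) :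
    ∀ᵐ x ∂P, X x = Y x := by
  have hmax := (integral_abs_departure_sub_le hτ hX hY hω hXτ hYτ hωτ hω0 hXst hYst hXi hYi).2 hge
  have hZ := measurable_maxSeq hX hY
  have hZst : ∀ᵐ x ∂P, Stable (maxSeq (X x) (Y x)) (ω x) :=
    hXst.mono fun x hx => hx.mono (le_maxSeq_left _ _)
  have hidle := ae_exists_idle_ge hτ hZ hω (fun l x => by rw [hXτ, hYτ]; rfl) hωτ hZst
  have hcross : ∀ p q, ∀ᵐ x ∂P, ¬ (X x p < Y x p ∧ Y x q < X x q) := by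
    intro p q
    set S : BiSeq × BiSeq → ℝ := fun z =>
      ∑ k ∈ Finset.Icc (min p q) (max p q), maxSeq z.1 z.2 k
    have hS : Measurable S := by
      simp only [S, maxSeq]
      fun_prop
    -- Capping the sum over the window by `N` yields an event depending on the two sequences only.
    -- By `hbig` it can be combined with a service longer than `N` just before the window.
    set B : ℕ → Set (BiSeq × BiSeq) := fun N => {z | (z.1 p < z.2 p ∧ z.2 q < z.1 q) ∧ S z ≤ N}
    have hB : ∀ N, MeasurableSet (B N) := by
      intro N
      have m1 : MeasurableSet {z : BiSeq × BiSeq | z.1 p < z.2 p} :=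
        measurableSet_lt (by fun_prop) (by fun_prop)
      have m2 : MeasurableSet {z : BiSeq × BiSeq | z.2 q < z.1 q} :=
        measurableSet_lt (by fun_prop) (by fun_prop)
      exact (m1.inter m2).inter (measurableSet_le hS measurable_const)
    have hB0 : ∀ N, P {x | (X x, Y x) ∈ B N} = 0 := by
      intro N
      by_contra hne
      have h1 := hbig (B N) (hB N) (min p q - 1) N hne
      refine h1 ?_
      have h2 : ∀ᵐ x ∂P, ¬ ((X x, Y x) ∈ B N ∧ N < ω x (min p q - 1)) := by
        filter_upwards [hmax, hidle, hXst, hYst, hZst, hX0, hω0]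
          with x hm hi hx hy hz hx0 hw0 ⟨⟨⟨hp, hq⟩, hs⟩, hN⟩
        obtain ⟨M, hM⟩ := exists_max_departure_lt hx.finiteQueue hy.finiteQueue hz.finiteQueue hx0
          hw0 hp hq (lt_of_le_of_lt hs hN) (hi _)
        exact hM.ne (hm M).symm
      simpa [ae_iff] using h2
    have h3 : ∀ᵐ x ∂P, ∀ N, (X x, Y x) ∉ B N :=
      ae_all_iff.2 fun N => measure_eq_zero_iff_ae_notMem.1 (hB0 N)
    filter_upwards [h3] with x hx hc
    obtain ⟨N, hN⟩ := exists_nat_ge (S (X x, Y x))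
    exact hx N ⟨hc, hN⟩
  have h1 := ae_forall_le_of_not_cross hτ hX hY hXτ hYτ hXi hYi hinv hcross
  have h2 := ae_forall_le_of_not_cross hτ hY hX hYτ hXτ hYi hXi
    (fun A hA hAτ => (hinv A hA hAτ).symm) (fun p q => (hcross q p).mono fun x hx h => hx h.symm)
  filter_upwards [h1, h2] with x hx hx'
  exact funext fun k => le_antisymm (hx' k) (hx k)

end Stationary

/-! ### Ergodic marginals -/

lemma translate_natCast {n : ℕ} (m : ℕ) :
    (translate (m : ℤ) : Config n → Config n) = (translate 1)^[m] := by
  induction m with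
  | zero => exact funext translate_zero
  | succ m ih =>
    rw [Function.iterate_succ', ← ih]
    funext η
    simp [translate_add, add_comm]

lemma IsTranslationErgodic.ergodic {n : ℕ} {μ : Measure (Config n)} [IsProbabilityMeasure μ]
    (h : IsTranslationErgodic μ) : Ergodic (translate 1) μ := by
  refine ⟨h.invariant 1, ⟨fun s hs hinv => ?_⟩⟩
  have hnat : ∀ m : ℕ, translate (m : ℤ) ⁻¹' s = s := by
    intro m
    rw [translate_natCast, Set.preimage_iterate_eq]
    exact Function.iterate_fixed hinv m
  have hall : ∀ l : ℤ, translate l ⁻¹' s = s := by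
    intro l
    obtain ⟨m, rfl | rfl⟩ := l.eq_nat_or_neg
    · exact hnat m
    · conv_lhs => rw [← hnat m]
      ext η
      simp [translate_add, translate_zero]
  rw [eventuallyConst_set']
  rcases h.trivial_of_invariant s hs hall with h0 | h1
  · exact Or.inl (ae_eq_empty.2 h0)
  · exact Or.inr (ae_eq_univ.2 ((prob_compl_eq_zero_iff hs).2 h1))

/-- If a stationary system is mapped equivariantly to an ergodic one, then invariant events are
uncorrelated with the image. -/
lemma setIntegral_of_equivariant {n : ℕ} {μ : Measure (Config n)} [IsProbabilityMeasure μ]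
    (h : IsTranslationErgodic μ) {Ω : Type*} [MeasurableSpace Ω] {P : Measure Ω}
    [IsProbabilityMeasure P] {T : Ω → Ω} (hT : MeasurePreserving T P P) {f : Ω → Config n}
    (hf : MeasurePreserving f P μ) (hfT : ∀ x, f (T x) = translate 1 (f x)) {A : Set Ω}
    (hA : MeasurableSet A) (hAT : T ⁻¹' A = A) {g : Config n → ℝ} (hg : Measurable g) :
    ∫ x in A, g (f x) ∂P = P.real A * ∫ η, g η ∂μ := by
  -- The image of `P` restricted to `A` is translation-invariant and absolutely continuous with
  -- respect to the ergodic `μ`, hence a multiple of it, with factor `P A`.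
  set ν := (P.restrict A).map f with hν
  have hTA : MeasurePreserving T (P.restrict A) (P.restrict A) := by
    have := hT.restrict_preimage hA
    rwa [hAT] at this
  have hνT : MeasurePreserving (translate 1) ν ν := by
    refine ⟨measurable_translate 1, ?_⟩
    rw [hν, Measure.map_map (measurable_translate 1) hf.measurable]
    have e : translate 1 ∘ f = f ∘ T := funext fun x => (hfT x).symm
    rw [e, ← Measure.map_map hf.measurable hT.measurable, hTA.map_eq]
  have hνμ : ν ≪ μ := by
    rw [hν, ← hf.map_eq]
    exact Measure.restrict_le_self.absolutelyContinuous.map hf.measurable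
  obtain ⟨c, hc⟩ := h.ergodic.eq_smul_of_absolutelyContinuous hνT hνμ
  have hcA : c = P A := by
    have h1 := congrArg (fun m : Measure (Config n) => m Set.univ) hc
    simp only [hν, Measure.map_apply hf.measurable MeasurableSet.univ, Set.preimage_univ,
      Measure.restrict_apply MeasurableSet.univ, Set.univ_inter, Measure.smul_apply, smul_eq_mul,
      measure_univ, mul_one] at h1
    exact h1.symm
  have h2 := integral_map (μ := P.restrict A) hf.measurable.aemeasurable
    (f := g) hg.aestronglyMeasurable
  rw [← h2, ← hν, hc, integral_smul_measure, hcA]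
  rfl

/-! ### Optimal stationary couplings -/

/-- The integral is the supremum of the integrals of the truncations at level `N`, each weakly
continuous. -/
lemma lowerSemicontinuous_lintegral_probabilityMeasure {E : Type*} [TopologicalSpace E]
    [MeasurableSpace E] [OpensMeasurableSpace E] {f : E → NNReal} (hf : Continuous f) :
    LowerSemicontinuous fun p : ProbabilityMeasure E => ∫⁻ x, f x ∂(p : Measure E) := by
  set g : ℕ → BoundedContinuousFunction E NNReal := fun N =>
    BoundedContinuousFunction.mkOfBound ⟨fun x => min (f x) N, by fun_prop⟩ N fun x y => by
      rw [NNReal.dist_eq]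
      have h1 : ((min (f x) N : NNReal) : ℝ) ≤ N := by exact_mod_cast min_le_right _ _
      have h2 : ((min (f y) N : NNReal) : ℝ) ≤ N := by exact_mod_cast min_le_right _ _
      exact abs_sub_le_of_nonneg_of_le (NNReal.coe_nonneg _) h1 (NNReal.coe_nonneg _) h2
  have hg : ∀ N x, g N x = min (f x) N := fun N x => rfl
  have e : (fun p : ProbabilityMeasure E => ∫⁻ x, f x ∂(p : Measure E)) =
      fun p : ProbabilityMeasure E => ⨆ N, ∫⁻ x, g N x ∂(p : Measure E) := by
    funext p
    rw [← lintegral_iSup]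
    · refine lintegral_congr fun x => le_antisymm ?_ (iSup_le fun N => ?_)
      · obtain ⟨N, hN⟩ := exists_nat_ge (f x)
        refine le_iSup_of_le N ?_
        rw [hg, min_eq_left hN]
      · rw [hg]
        exact_mod_cast min_le_left _ _
    · intro N
      exact ((g N).continuous.measurable).coe_nnreal_ennreal
    · intro N M hNM x
      simp only [hg]
      exact_mod_cast min_le_min_left _ (by exact_mod_cast hNM)
  rw [e]
  exact lowerSemicontinuous_iSup fun N =>
    (ProbabilityMeasure.continuous_lintegral_boundedContinuousFunction (g N)).lowerSemicontinuous

/-- Couplings of `μ` and `μ'` that are invariant under simultaneous translations. -/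
structure IsStationaryCoupling {n : ℕ} (μ μ' : Measure (Config n))
    (κ : Measure (Config n × Config n)) : Prop where
  fst : MeasurePreserving Prod.fst κ μ
  snd : MeasurePreserving Prod.snd κ μ'
  invariant : ∀ l, MeasurePreserving (Prod.map (translate l) (translate l)) κ κ

/-- The `ℓ¹` distance of two configurations at site `0`. -/
def siteDist {n : ℕ} (z : Config n × Config n) : NNReal := ∑ i, ‖z.1 i 0 - z.2 i 0‖₊

lemma continuous_siteDist {n : ℕ} : Continuous (siteDist : Config n × Config n → NNReal) := by
  unfold siteDist
  fun_prop

lemma continuous_translate {n : ℕ} (l : ℤ) :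
    Continuous (translate l : Config n → Config n) := by
  unfold translate
  fun_prop

/-- The stationary couplings form a weakly closed set, tight because both marginals are fixed and
nonempty because of the product; on this compact set a lower semicontinuous cost attains its
minimum. -/
lemma exists_optimal_coupling {n : ℕ} {μ μ' : Measure (Config n)} [IsProbabilityMeasure μ]
    [IsProbabilityMeasure μ'] (h : ∀ l, MeasurePreserving (translate l) μ μ)
    (h' : ∀ l, MeasurePreserving (translate l) μ' μ') :
    ∃ κ, IsProbabilityMeasure κ ∧ IsStationaryCoupling μ μ' κ ∧
      ∀ κ', IsProbabilityMeasure κ' → IsStationaryCoupling μ μ' κ' →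
        ∫⁻ z, siteDist z ∂κ ≤ ∫⁻ z, siteDist z ∂κ' := by
  set S : Set (ProbabilityMeasure (Config n × Config n)) :=
    {p | IsStationaryCoupling μ μ' (p : Measure (Config n × Config n))}
  have hT : ∀ l, Continuous (Prod.map (translate l) (translate l) :
      Config n × Config n → Config n × Config n) :=
    fun l => (continuous_translate l).prodMap (continuous_translate l)
  have hclosed : IsClosed S := by
    have e : S =
        {p | p.map (f := Prod.fst) continuous_fst.measurable.aemeasurable = ⟨μ, inferInstance⟩} ∩
        ({p | p.map (f := Prod.snd) continuous_snd.measurable.aemeasurable = ⟨μ', inferInstance⟩} ∩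
        ⋂ l, {p | p.map (hT l).measurable.aemeasurable = p}) := by
      ext p
      simp only [Set.mem_inter_iff, Set.mem_iInter, Set.mem_ofPred_eq, S]
      exact ⟨fun hp => ⟨Subtype.ext hp.fst.map_eq, Subtype.ext hp.snd.map_eq,
          fun l => Subtype.ext (hp.invariant l).map_eq⟩,
        fun hp => ⟨⟨measurable_fst, congrArg Subtype.val hp.1⟩,
          ⟨measurable_snd, congrArg Subtype.val hp.2.1⟩,
          fun l => ⟨(hT l).measurable, congrArg Subtype.val (hp.2.2 l)⟩⟩⟩
    rw [e]
    refine (isClosed_eq (ProbabilityMeasure.continuous_map continuous_fst) continuous_const).inter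
      ((isClosed_eq (ProbabilityMeasure.continuous_map continuous_snd) continuous_const).inter
      (isClosed_iInter fun l => isClosed_eq (ProbabilityMeasure.continuous_map (hT l))
        continuous_id))
  have htight : IsTightMeasureSet {((p : ProbabilityMeasure (Config n × Config n)) :
      Measure (Config n × Config n)) | p ∈ S} := by
    refine IsTightMeasureSet.prodMk ?_ ?_
    · refine (isTightMeasureSet_singleton (μ := μ)).subset ?_
      rintro _ ⟨_, ⟨p, hp, rfl⟩, rfl⟩
      exact hp.fst.map_eq
    · refine (isTightMeasureSet_singleton (μ := μ')).subset ?_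
      rintro _ ⟨_, ⟨p, hp, rfl⟩, rfl⟩
      exact hp.snd.map_eq
  have hcompact : IsCompact S := by
    have := isCompact_closure_of_isTightMeasureSet htight
    rwa [hclosed.closure_eq] at this
  have hne : S.Nonempty := ⟨⟨μ.prod μ', inferInstance⟩, measurePreserving_fst,
    measurePreserving_snd, fun l => (h l).prod (h' l)⟩
  obtain ⟨p, hp, hmin⟩ := LowerSemicontinuousOn.exists_isMinOn hne hcompact
    ((lowerSemicontinuous_lintegral_probabilityMeasure
      (continuous_siteDist (n := n))).lowerSemicontinuousOn S)
  exact ⟨p, p.2, hp, fun κ' h1 h2 => hmin (show (⟨κ', h1⟩ : ProbabilityMeasure _) ∈ S from h2)⟩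

/-! ### The means of invariant measures -/

/-- The nonnegative variable `D - ω` has mean `ρ i - 1`. If this were `0`, departures would equal
services almost surely, but a stable queue idles, and at an idle time `D > ω`. -/
lemma one_lt_of_invariant {n : ℕ} {μ : Measure (Config n)} [IsProbabilityMeasure μ]
    (hμ : ∀ l, MeasurePreserving (translate l) μ μ) {ρ : Fin n → ℝ} (hρ : HasMeanVector μ ρ)
    (hinv : IsInvariantForCoupled μ) (i : Fin n) : 1 < ρ i := by
  set P := μ.prod (expSeq 1) with hP
  set X : Config n × BiSeq → BiSeq := fun x => x.1 i
  have hX : Measurable X := (measurable_pi_apply i).comp measurable_fst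
  have hfst : MeasurePreserving Prod.fst P μ := measurePreserving_fst
  have hsnd : MeasurePreserving Prod.snd P (expSeq 1) := measurePreserving_snd
  have hτ : MeasurePreserving (Prod.map (translate 1) (shift 1)) P P :=
    (hμ 1).prod (measurePreserving_shift_expSeq 1 1)
  have hω0 : ∀ᵐ x ∂P, ∀ k, 0 ≤ x.2 k :=
    hsnd.quasiMeasurePreserving.ae (expSeq_ae_nonneg 1)
  have hXi : ∀ l, Integrable (fun x => X x l) P := fun l =>
    hfst.integrable_comp_of_integrable (hρ i l).1
  have hXm : ∀ l, ∫ x, X x l ∂P = ρ i := by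
    intro l
    have hm : Measurable fun η : Config n => η i l := by fun_prop
    rw [← (hρ i l).2, ← hfst.map_eq,
      integral_map hfst.measurable.aemeasurable hm.aestronglyMeasurable]
  have hωi : ∀ l, Integrable (fun x : Config n × BiSeq => x.2 l) P := fun l =>
    hsnd.integrable_comp_of_integrable (integrable_expSeq one_pos l)
  have hωm : ∀ l, ∫ x, x.2 l ∂P = 1 := by
    intro l
    rw [← integral_expSeq one_pos l, ← hsnd.map_eq,
      integral_map hsnd.measurable.aemeasurable (measurable_pi_apply l).aestronglyMeasurable]
  have hst : ∀ᵐ x ∂P, Stable (X x) x.2 := hinv.stable.mono fun x hx => hx i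
  have hfin := hst.mono fun x hx => hx.finiteQueue
  have hD := fun l => integrable_departure hτ hX measurable_snd (fun _ => rfl) (fun _ => rfl)
    hfin hω0 (hXi l)
  have hdi : ∀ l, Integrable (fun x => departure (X x) x.2 l - x.2 l) P := fun l =>
    (hD l).1.sub (hωi l)
  have hdm : ∀ l, ∫ x, (departure (X x) x.2 l - x.2 l) ∂P = ρ i - 1 := by
    intro l
    rw [integral_sub (hD l).1 (hωi l), (hD l).2, hXm, hωm]
  have hnn : ∀ l, 0 ≤ᵐ[P] fun x => departure (X x) x.2 l - x.2 l := by
    intro l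
    filter_upwards [hfin] with x hx
    exact sub_nonneg.2 (hx.le_departure l)
  have hge : 0 ≤ ρ i - 1 := by
    rw [← hdm 0]
    exact integral_nonneg_of_ae (hnn 0)
  by_contra hle
  have hzero : ρ i - 1 = 0 := by linarith
  have heq : ∀ᵐ x ∂P, ∀ l, departure (X x) x.2 l = x.2 l := by
    refine ae_all_iff.2 fun l => ?_
    have h1 := (integral_eq_zero_iff_of_nonneg_ae (hnn l) (hdi l)).1 ((hdm l).trans hzero)
    filter_upwards [h1] with x hx
    exact sub_eq_zero.1 hx
  obtain ⟨x, hx1, hx2, hx3⟩ := (heq.and (hst.and hfin)).exists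
  obtain ⟨k, -, hk⟩ := hx2.exists_idle 0
  have h1 := hx3.departure_succ (k - 1)
  rw [sub_add_cancel, hx1 k, max_eq_left (by linarith)] at h1
  linarith

/-! ### Uniqueness -/

lemma prod_expSeq_ne_zero {α : Type*} [MeasurableSpace α] {κ : Measure α} [SFinite κ]
    {B : Set α} (hB : κ.prod (expSeq 1) (Prod.fst ⁻¹' B) ≠ 0) (k : ℤ) (c : ℝ) :
    κ.prod (expSeq 1) {x | x.1 ∈ B ∧ c < x.2 k} ≠ 0 := by
  have e1 : (Prod.fst ⁻¹' B : Set (α × BiSeq)) = B ×ˢ Set.univ := by ext; simp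
  have e2 : {x : α × BiSeq | x.1 ∈ B ∧ c < x.2 k} = B ×ˢ ((fun ω : BiSeq => ω k) ⁻¹' Set.Ioi c) :=
    rfl
  rw [e1, Measure.prod_prod, measure_univ, mul_one] at hB
  rw [e2, Measure.prod_prod,
    (measurePreserving_eval_expSeq 1 k).measure_preimage measurableSet_Ioi.nullMeasurableSet]
  exact mul_ne_zero hB (expMean_Ioi_pos one_pos c).ne'

lemma measurable_pairStep (n : ℕ) : Measurable fun x : (Config n × Config n) × BiSeq =>
    (coupledStep x.1.1 x.2, coupledStep x.1.2 x.2) := by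
  refine Measurable.prodMk (measurable_pi_lambda _ fun i => ?_)
    (measurable_pi_lambda _ fun i => ?_)
  · exact measurable_departure (f := fun x : (Config n × Config n) × BiSeq => x.1.1 i)
      (g := fun x => x.2) (by fun_prop) (by fun_prop)
  · exact measurable_departure (f := fun x : (Config n × Config n) × BiSeq => x.1.2 i)
      (g := fun x => x.2) (by fun_prop) (by fun_prop)

/-- Driving both marginals with the same services produces a competitor for the optimal coupling. -/
lemma IsStationaryCoupling.step {n : ℕ} {μ μ' : Measure (Config n)} [SFinite μ] [SFinite μ']
    {κ : Measure (Config n × Config n)} [SFinite κ] (h : IsStationaryCoupling μ μ' κ)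
    (hμ : IsInvariantForCoupled μ) (hμ' : IsInvariantForCoupled μ') :
    IsStationaryCoupling μ μ' ((κ.prod (expSeq 1)).map
      fun x => (coupledStep x.1.1 x.2, coupledStep x.1.2 x.2)) := by
  have hid := MeasurePreserving.id (expSeq 1)
  have h1 : MeasurePreserving (fun x : (Config n × Config n) × BiSeq => coupledStep x.1.1 x.2)
      (κ.prod (expSeq 1)) μ := by
    have := hμ.measurePreserving.comp (h.fst.prod hid)
    exact this
  have h2 : MeasurePreserving (fun x : (Config n × Config n) × BiSeq => coupledStep x.1.2 x.2)
      (κ.prod (expSeq 1)) μ' := by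
    have := hμ'.measurePreserving.comp (h.snd.prod hid)
    exact this
  have hm := measurable_pairStep n
  refine ⟨⟨measurable_fst, ?_⟩, ⟨measurable_snd, ?_⟩, fun l => ?_⟩
  · rw [Measure.map_map measurable_fst hm]
    exact h1.map_eq
  · rw [Measure.map_map measurable_snd hm]
    exact h2.map_eq
  · have hT := (h.invariant l).prod (measurePreserving_shift_expSeq 1 l)
    refine ⟨(h.invariant l).measurable, ?_⟩
    rw [Measure.map_map (h.invariant l).measurable hm]
    conv_rhs => rw [← hT.map_eq, Measure.map_map hm hT.measurable]
    congr 1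
    funext x
    simp only [Function.comp_apply, Prod.map_apply, Prod.map_fst, Prod.map_snd,
      coupledStep_translate]

lemma coe_siteDist {n : ℕ} (z : Config n × Config n) :
    (siteDist z : ENNReal) = ENNReal.ofReal (∑ i, |z.1 i 0 - z.2 i 0|) := by
  rw [← ENNReal.ofReal_coe_nnreal]
  congr 1
  simp [siteDist]

lemma lintegral_siteDist {n : ℕ} {Ω : Type*} [MeasurableSpace Ω] {P : Measure Ω}
    {f g : Ω → Config n} (h : ∀ i, Integrable (fun x => |f x i 0 - g x i 0|) P) :
    ∫⁻ x, siteDist (f x, g x) ∂P = ENNReal.ofReal (∑ i, ∫ x, |f x i 0 - g x i 0| ∂P) := by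
  simp only [coe_siteDist]
  rw [← ofReal_integral_eq_lintegral_ofReal (integrable_finsetSum _ fun i _ => h i)
      (ae_of_all _ fun x => Finset.sum_nonneg fun i _ => abs_nonneg _),
    integral_finsetSum _ fun i _ => h i]

/-- Two translation-ergodic measures with the same mean vector that are invariant for the coupled
process coincide. -/
theorem eq_of_isInvariantForCoupled {n : ℕ} {μ μ' : Measure (Config n)} [IsProbabilityMeasure μ]
    [IsProbabilityMeasure μ'] (he : IsTranslationErgodic μ) (he' : IsTranslationErgodic μ')
    {ρ : Fin n → ℝ} (hρ : HasMeanVector μ ρ) (hρ' : HasMeanVector μ' ρ)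
    (h0 : ∀ᵐ η ∂μ, ∀ i k, 0 ≤ η i k)
    (hμ : IsInvariantForCoupled μ) (hμ' : IsInvariantForCoupled μ') : μ' = μ := by
  obtain ⟨κ, hκ, hc, hmin⟩ := exists_optimal_coupling he.invariant he'.invariant
  set P := κ.prod (expSeq 1) with hP
  have hfst : MeasurePreserving Prod.fst P κ := measurePreserving_fst
  have hsnd : MeasurePreserving Prod.snd P (expSeq 1) := measurePreserving_snd
  have hL : MeasurePreserving (fun x : (Config n × Config n) × BiSeq => x.1.1) P μ :=
    hc.fst.comp hfst
  have hR : MeasurePreserving (fun x : (Config n × Config n) × BiSeq => x.1.2) P μ' :=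
    hc.snd.comp hfst
  set τ : ℤ → (Config n × Config n) × BiSeq → (Config n × Config n) × BiSeq := fun l =>
    Prod.map (Prod.map (translate l) (translate l)) (shift l)
  have hτ : ∀ l, MeasurePreserving (τ l) P P := fun l =>
    (hc.invariant l).prod (measurePreserving_shift_expSeq 1 l)
  set X : Fin n → (Config n × Config n) × BiSeq → BiSeq := fun i x => x.1.1 i
  set Y : Fin n → (Config n × Config n) × BiSeq → BiSeq := fun i x => x.1.2 i
  have hX : ∀ i, Measurable (X i) := fun i => (measurable_pi_apply i).comp hL.measurable
  have hY : ∀ i, Measurable (Y i) := fun i => (measurable_pi_apply i).comp hR.measurable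
  have hω0 : ∀ᵐ x ∂P, ∀ k, 0 ≤ x.2 k := hsnd.quasiMeasurePreserving.ae (expSeq_ae_nonneg 1)
  have hXi : ∀ i, Integrable (fun x => X i x 0) P := fun i =>
    hL.integrable_comp_of_integrable (hρ i 0).1
  have hYi : ∀ i, Integrable (fun x => Y i x 0) P := fun i =>
    hR.integrable_comp_of_integrable (hρ' i 0).1
  have hid := MeasurePreserving.id (expSeq 1)
  have hXst : ∀ i, ∀ᵐ x ∂P, Stable (X i x) x.2 := fun i =>
    ((hc.fst.prod hid).quasiMeasurePreserving.ae hμ.stable).mono fun x hx => hx i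
  have hYst : ∀ i, ∀ᵐ x ∂P, Stable (Y i x) x.2 := fun i =>
    ((hc.snd.prod hid).quasiMeasurePreserving.ae hμ'.stable).mono fun x hx => hx i
  have hcontr := fun i => (integral_abs_departure_sub_le hτ (hX i) (hY i) measurable_snd
    (fun _ _ => rfl) (fun _ _ => rfl) (fun _ _ => rfl) hω0 (hXst i) (hYst i) (hXi i) (hYi i)).1
  have hDX := fun i => (integrable_departure (hτ 1) (hX i) measurable_snd (fun _ => rfl)
    (fun _ => rfl) ((hXst i).mono fun x hx => hx.finiteQueue) hω0 (hXi i)).1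
  have hDY := fun i => (integrable_departure (hτ 1) (hY i) measurable_snd (fun _ => rfl)
    (fun _ => rfl) ((hYst i).mono fun x hx => hx.finiteQueue) hω0 (hYi i)).1
  have hXY : ∀ i, Integrable (fun x => |X i x 0 - Y i x 0|) P := fun i => ((hXi i).sub (hYi i)).abs
  have hDXY : ∀ i, Integrable
      (fun x => |departure (X i x) x.2 0 - departure (Y i x) x.2 0|) P := fun i =>
    ((hDX i).sub (hDY i)).abs
  have hstep := hc.step hμ hμ'
  have hm := measurable_pairStep n
  -- Minimality bounds the total distance before the step by that after it. Since each line
  -- contracts separately, equality of the sums forces equality in every line.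
  have hle := hmin _ (Measure.isProbabilityMeasure_map hm.aemeasurable) hstep
  have hsite : Measurable fun z : Config n × Config n => (siteDist z : ENNReal) :=
    continuous_siteDist.measurable.coe_nnreal_ennreal
  rw [← hP, lintegral_map hsite hm, ← hfst.lintegral_comp hsite] at hle
  have e1 : ∫⁻ x, siteDist x.1 ∂P = ENNReal.ofReal (∑ i, ∫ x, |X i x 0 - Y i x 0| ∂P) :=
    lintegral_siteDist (f := fun x : (Config n × Config n) × BiSeq => x.1.1)
      (g := fun x => x.1.2) hXY
  have e2 := lintegral_siteDist (f := fun x : (Config n × Config n) × BiSeq =>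
    coupledStep x.1.1 x.2) (g := fun x => coupledStep x.1.2 x.2) hDXY
  have hsum : ∑ i, ∫ x, |X i x 0 - Y i x 0| ∂P ≤
      ∑ i, ∫ x, |departure (X i x) x.2 0 - departure (Y i x) x.2 0| ∂P :=
    (ENNReal.ofReal_le_ofReal_iff (Finset.sum_nonneg fun i _ =>
      integral_nonneg fun x => abs_nonneg _)).1 ((e1.symm.le.trans hle).trans e2.le)
  have hge : ∀ i, ∫ x, |X i x 0 - Y i x 0| ∂P ≤
      ∫ x, |departure (X i x) x.2 0 - departure (Y i x) x.2 0| ∂P := fun i =>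
    ((Finset.sum_eq_sum_iff_of_le fun i _ => hcontr i).1
      (le_antisymm (Finset.sum_le_sum fun i _ => hcontr i) hsum) i (Finset.mem_univ i)).ge
  have hmeas0 : ∀ i, Measurable fun η : Config n => η i 0 := fun i => by fun_prop
  have heq : ∀ i, ∀ᵐ x ∂P, X i x = Y i x := by
    intro i
    refine ae_eq_of_integral_abs_le hτ (hX i) (hY i) measurable_snd
      (fun _ _ => rfl) (fun _ _ => rfl) (fun _ _ => rfl) hω0
      ((hL.quasiMeasurePreserving.ae h0).mono fun x hx => hx i) (hXst i) (hYst i) (hXi i) (hYi i)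
      (fun A hA hAτ => ?_) (fun B hB k N hne => ?_) (hge i)
    · have h1 := setIntegral_of_equivariant he (hτ 1) hL (fun _ => rfl) hA (hAτ 1) (hmeas0 i)
      have h2 := setIntegral_of_equivariant he' (hτ 1) hR (fun _ => rfl) hA (hAτ 1) (hmeas0 i)
      rw [(hρ i 0).2] at h1
      rw [(hρ' i 0).2] at h2
      exact h1.trans h2.symm
    · exact prod_expSeq_ne_zero (B := {z : Config n × Config n | (z.1 i, z.2 i) ∈ B})
        hne k N
  have hLR : (fun x : (Config n × Config n) × BiSeq => x.1.2) =ᵐ[P] fun x => x.1.1 := by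
    filter_upwards [ae_all_iff.2 heq] with x hx
    exact funext fun i => (hx i).symm
  rw [← hL.map_eq, ← hR.map_eq]
  exact Measure.map_congr hLR

end CoupledQueues

end

/-! ### The theorem. -/

theorem theorem5p3 (n : ℕ) :
    -- existence: `μ^ρ` is a translation-ergodic invariant measure with mean vector `ρ`
    (∀ ρ : Fin n → ℝ, (∀ i, 1 < ρ i) →
      IsProbabilityMeasure (CoupledQueues.mu ρ) ∧
      (∀ᵐ η ∂(CoupledQueues.mu ρ), η ∈ CoupledQueues.stateSpace n) ∧
      CoupledQueues.IsTranslationErgodic (CoupledQueues.mu ρ) ∧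
      CoupledQueues.HasMeanVector (CoupledQueues.mu ρ) ρ ∧
      CoupledQueues.IsInvariantForCoupled (CoupledQueues.mu ρ)) ∧
    -- uniqueness on the state space `A_n`
    (∀ ρ : Fin n → ℝ, (∀ i, 1 < ρ i) →
      ∀ μ' : Measure (CoupledQueues.Config n), IsProbabilityMeasure μ' →
      (∀ᵐ η ∂μ', η ∈ CoupledQueues.stateSpace n) →
      CoupledQueues.IsTranslationErgodic μ' →
      CoupledQueues.HasMeanVector μ' ρ →
      CoupledQueues.IsInvariantForCoupled μ' →
      μ' = CoupledQueues.mu ρ) ∧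
    -- uniqueness on the space `X_n` of ordered configurations
    (∀ ρ : Fin n → ℝ,
      ∀ μ' : Measure (CoupledQueues.Config n), IsProbabilityMeasure μ' →
      (∀ᵐ η ∂μ', η ∈ CoupledQueues.orderedSpace n) →
      CoupledQueues.IsTranslationErgodic μ' →
      CoupledQueues.HasMeanVector μ' ρ →
      CoupledQueues.IsInvariantForCoupled μ' →
      (∀ i, 1 < ρ i) ∧ μ' = CoupledQueues.mu ρ) := by
  open CoupledQueues in
  refine ⟨fun ρ hρ => ?_, fun ρ hρ μ' _ hs he hm hi => ?_, fun ρ μ' _ hs he hm hi => ?_⟩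
  · exact ⟨inferInstance, mu_ae_mem_stateSpace hρ, isTranslationErgodic_mu ρ,
      hasMeanVector_mu fun i => one_pos.trans (hρ i), isInvariantForCoupled_mu hρ⟩
  · exact (eq_of_isInvariantForCoupled he (isTranslationErgodic_mu ρ) hm
      (hasMeanVector_mu fun i => one_pos.trans (hρ i)) (hs.mono fun η hη => hη.1) hi
      (isInvariantForCoupled_mu hρ)).symm
  · have hρ := one_lt_of_invariant he.invariant hm hi
    exact ⟨hρ, (eq_of_isInvariantForCoupled he (isTranslationErgodic_mu ρ) hm
      (hasMeanVector_mu fun i => one_pos.trans (hρ i)) (hs.mono fun η hη => hη.1) hi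
      (isInvariantForCoupled_mu hρ)).symm⟩
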